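/- Let $0<T_1<T_2<T_3<\cdots$ be the points, in increasing order, of a Poisson process on the positive real line with constant intensity $\tfrac12$. Almost surely there is a unique real number $\sigma>\tfrac12$ with $$T_1^{-2\sigma}=\sum_{j=2}^{\infty}T_j^{-2\sigma};$$ denote it by $\sigma_{\{T_j\}}$. It is a well-defined random variable. Let $\gamma(s,z)$ denote the lower incomplete gamma function, defined for $z\in\mathbb C\setminus\mathbb R_{<0}$ and $\operatorname{Re}s>0$ by $\gamma(s,z)=\int_0^z u^{s-1}e^{-u}\,du$ (path of integration in $\mathbb C\setminus\mathbb R_{<0}$, $|\arg u|<\pi$), and extended to all $s\in\mathbb C\setminus\mathbb Z_{\le 0}$ by the recursion formula $\gamma(s,z)=\bigl(\gamma(s+1,z)+z^se^{-z}\bigr)/s$. Then for every real $c>\tfrac12$ one has $\gamma(-\tfrac1{2c},-iy)\neq0$ for all $y>0$, and $$\operatorname{Prob}\bigl(\sigma_{\{T_j\}}\le c\bigr)=\frac12+\frac{2c}{\pi}\int_0^\infty \operatorname{Im}\!\left(\frac{e^{(\frac{\pi}{4c}-y)i}}{\gamma(-\frac1{2c},-iy)}\right)y^{-1-\frac1{2c}}\,dy,$$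 where the integral on the right-hand side is absolutely convergent. -/

import Mathlib

open MeasureTheory ProbabilityTheory Set
open scoped NNReal

noncomputable section

/-- The number of terms of the sequence `x` that lie in the set `B` (possibly infinite). -/
def pointCount (x : ℕ → ℝ) (B : Set ℝ) : ℕ∞ := {j : ℕ | x j ∈ B}.encard

/-- `T 0 < T 1 < T 2 < ⋯` are the points, in increasing order, of a Poisson process with constant
intensity `r` on the positive real line: the random variables `T j` are almost surely positive and
strictly increasing in `j`, the number of points in a Borel set `B` of finite Lebesgue measure is
Poisson distributed with mean `r * volume B`, and the numbers of points in finitely many pairwise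
disjoint Borel sets are independent. The first point is `T 0`. -/
structure IsPoissonPoints {Ω : Type*} [MeasurableSpace Ω] (r : ℝ≥0) (T : ℕ → Ω → ℝ)
    (P : Measure Ω) : Prop where
  measurable : ∀ j, Measurable (T j)
  pos : ∀ᵐ ω ∂P, 0 < T 0 ω
  strictMono : ∀ᵐ ω ∂P, StrictMono (fun j => T j ω)
  count_law : ∀ B : Set ℝ, MeasurableSet B → B ⊆ Ioi 0 → volume B < ⊤ → ∀ n : ℕ,
    P {ω | pointCount (fun j => T j ω) B = n} = poissonMeasure (r * (volume B).toNNReal) {n}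
  count_indep : ∀ (m : ℕ) (B : Fin m → Set ℝ), (∀ i, MeasurableSet (B i)) →
    (∀ i, B i ⊆ Ioi 0) → Pairwise (fun i k => Disjoint (B i) (B k)) →
    iIndepFun (fun i ω => pointCount (fun j => T j ω) (B i)) P

/-- `σ > 1/2` and `x₁ ^ (-2σ) = ∑_{j ≥ 2} x_j ^ (-2σ)`, the series being convergent; here the
sequence is indexed from `0`, so that `x₁` is `x 0`. -/
def IsCriticalExponent (x : ℕ → ℝ) (σ : ℝ) : Prop :=
  1 / 2 < σ ∧ HasSum (fun j : ℕ => x (j + 1) ^ (-(2 * σ))) (x 0 ^ (-(2 * σ)))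

open Classical in
/-- The unique critical exponent of the sequence `x` (and `0` if there is no such unique number). -/
def criticalExponent (x : ℕ → ℝ) : ℝ :=
  if h : ∃! σ, IsCriticalExponent x σ then h.choose else 0

/-- The integral `∫_0^z u^(s-1) e^(-u) du` along the line segment from `0` to `z`; for `Re s > 0`
and `z` off the negative real axis this is the lower incomplete gamma function. -/
def lowerGammaIntegral (s z : ℂ) : ℂ :=
  ∫ t in (0 : ℝ)..1, ((t : ℂ) * z) ^ (s - 1) * Complex.exp (-((t : ℂ) * z)) * z

/-- The `n`-fold application of the recursion `γ(s, z) = (γ(s + 1, z) + z ^ s e^(-z)) / s`,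
starting from the integral. -/
def lowerGammaAux : ℕ → ℂ → ℂ → ℂ
  | 0, s, z => lowerGammaIntegral s z
  | n + 1, s, z => (lowerGammaAux n (s + 1) z + z ^ s * Complex.exp (-z)) / s

/-- The lower incomplete gamma function `γ(s, z)`, for `s` not a non-positive integer and `z` off
the negative real axis: the recursion is used as often as is needed to reach `Re s > 0`. -/
def lowerGamma (s z : ℂ) : ℂ := lowerGammaAux ⌊1 - s.re⌋₊ s z

end

open Filter Topology
open scoped ENNReal

/-! Put `p = 2c > 1` and, with indices from `0`, `R = T₀ ^ p * ∑_{j ≥ 1} T_j ^ (-p)`. The ratios `T₀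
/ T_j` lie in `(0, 1)`, so the sum of their `p`-th powers strictly decreases in `p`. Almost surely
`∑ T_j ^ (-p)` converges for every `p > 1` and `∑ 1 / T_j` diverges, so that sum takes the value `1`
exactly once, and `σ ≤ c` if and only if `R ≤ 1` (`criticalExponent_le_iff`).

Given `T₀ = t`, the later points form a Poisson process on `(t, ∞)`. Campbell's formula
(`IsPoissonPoints.setIntegral_exp_tsum`) and scaling by `t` give the conditional characteristic
function `exp (r t Ψ(ξ))` of `R`, where `Ψ(ξ) = ∫₁^∞ (exp (i ξ v⁻ᵖ) - 1) dv`. As `T₀` is exponential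
with rate `r`, averaging yields `1 / (1 - Ψ(ξ))` (`IsPoissonPoints.integral_exp_ratio_sum`); the
intensity cancels.

Gil-Pelaez inversion (`gil_pelaez_zero`) for `R - 1` expresses `P(R ≤ 1)` through the imaginary part
of `exp (-iy) / (1 - Ψ(y))`. Integration by parts and one step of the recursion for `γ` identify
`γ(-1/p, -iy)` with `-p y^(-1/p) exp (iπ/(2p)) (1 - Ψ(y))` (`lowerGamma_neg_inv`). Since `Re Ψ ≤ 0`,
this never vanishes. Absolute convergence follows from `Im = O(y)` near `0` and the decay
`O(y^(-1/p))` of the characteristic function at infinity. -/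

/-! ### Measurability of counts and moments of the Poisson law -/

lemma natCast_le_pointCount_iff (x : ℕ → ℝ) (B : Set ℝ) (n : ℕ) :
    (n : ℕ∞) ≤ pointCount x B ↔ ∃ s : Finset ℕ, s.card = n ∧ ∀ j ∈ s, x j ∈ B := by
  constructor
  · intro h
    obtain ⟨t, ht, hn⟩ := Set.exists_subset_encard_eq h
    have hfin : t.Finite := Set.finite_of_encard_eq_coe hn
    refine ⟨hfin.toFinset, ?_, fun j hj => ht (hfin.mem_toFinset.1 hj)⟩
    have := hfin.encard_eq_coe_toFinset_card
    rw [hn] at this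
    exact_mod_cast this.symm
  · rintro ⟨s, rfl, hs⟩
    rw [← Set.encard_coe_eq_coe_finsetCard]
    exact Set.encard_le_encard fun j hj => hs j hj

/-- Having at least `n` points in `B` is a countable union, over the index sets `s` of size `n`, of
events about finitely many `T j`; the fibres of the count are built from these. -/
lemma measurable_pointCount {Ω : Type*} [MeasurableSpace Ω] {T : ℕ → Ω → ℝ}
    (hT : ∀ j, Measurable (T j)) {B : Set ℝ} (hB : MeasurableSet B) :
    Measurable fun ω => pointCount (fun j => T j ω) B := by
  have key : ∀ n : ℕ, MeasurableSet {ω | (n : ℕ∞) ≤ pointCount (fun j => T j ω) B} := by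
    intro n
    simp only [natCast_le_pointCount_iff, ofPred_exists]
    refine MeasurableSet.iUnion fun s => ?_
    by_cases hs : s.card = n
    · simp only [hs, true_and]
      have : {ω | ∀ j ∈ s, T j ω ∈ B} = ⋂ j ∈ s, T j ⁻¹' B := by ext; simp
      rw [this]
      exact Finset.measurableSet_biInter s fun j _ => hT j hB
    · simp [hs]
  refine measurable_to_countable' fun k => ?_
  induction k using ENat.recTopCoe with
  | top =>
    have : (fun ω => pointCount (fun j => T j ω) B) ⁻¹' {⊤} =
        ⋂ n : ℕ, {ω | (n : ℕ∞) ≤ pointCount (fun j => T j ω) B} := by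
      ext ω
      simp only [mem_preimage, mem_singleton_iff, mem_iInter, mem_ofPred_eq]
      rw [ENat.eq_top_iff_forall_ge]
    rw [this]
    exact MeasurableSet.iInter key
  | coe n =>
    have : (fun ω => pointCount (fun j => T j ω) B) ⁻¹' {(n : ℕ∞)} =
        {ω | (n : ℕ∞) ≤ pointCount (fun j => T j ω) B} \
          {ω | ((n + 1 : ℕ) : ℕ∞) ≤ pointCount (fun j => T j ω) B} := by
      ext ω
      simp only [mem_preimage, mem_singleton_iff, Set.mem_sdiff, mem_ofPred_eq]
      push_cast
      rw [ENat.add_one_le_iff (ENat.natCast_ne_top n), not_lt, le_antisymm_iff, and_comm]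
    rw [this]
    exact (key n).diff (key (n + 1))

lemma summable_of_lintegral_tsum_ne_top {Ω : Type*} [MeasurableSpace Ω] {P : Measure Ω}
    {X : ℕ → Ω → ℝ≥0} (hX : ∀ j, Measurable (X j)) (h : ∑' j, ∫⁻ ω, X j ω ∂P ≠ ⊤) :
    ∀ᵐ ω ∂P, Summable fun j => X j ω := by
  rw [← lintegral_tsum fun j => (hX j).coe_nnreal_ennreal.aemeasurable] at h
  filter_upwards [ae_lt_top' (by fun_prop) h] with ω hω
  exact ENNReal.tsum_coe_ne_top_iff_summable.1 hω.ne

lemma lintegral_natCast_poissonMeasure (r : ℝ≥0) :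
    ∫⁻ n, (n : ℝ≥0∞) ∂poissonMeasure r = r := by
  rw [lintegral_countable']
  simp_rw [poissonMeasure_singleton]
  rw [tsum_eq_zero_add' ENNReal.summable]
  have h : ∀ n : ℕ, ((n + 1 : ℕ) : ℝ≥0∞) *
      ENNReal.ofReal (Real.exp (-r) * r ^ (n + 1) / (n + 1).factorial) =
      r * ENNReal.ofReal (Real.exp (-r) * r ^ n / n.factorial) := by
    intro n
    rw [← ENNReal.ofReal_natCast, ← ENNReal.ofReal_mul (by positivity),
      ← ENNReal.ofReal_coe_nnreal (p := r), ← ENNReal.ofReal_mul (by positivity)]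
    congr 1
    rw [Nat.factorial_succ]
    push_cast
    field_simp
    ring
  simp_rw [h]
  rw [ENNReal.tsum_mul_left, ← ENNReal.ofReal_tsum_of_nonneg (fun n => by positivity)
    (hasSum_one_poissonMeasure r).summable, (hasSum_one_poissonMeasure r).tsum_eq]
  simp

lemma integral_exp_mul_poissonMeasure (r : ℝ≥0) (z : ℂ) :
    ∫ n, Complex.exp (z * n) ∂poissonMeasure r = Complex.exp (r * (Complex.exp z - 1)) := by
  rw [integral_poissonMeasure]
  have h : HasSum (fun n : ℕ => ((r : ℂ) * Complex.exp z) ^ n / n.factorial)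
      (Complex.exp (r * Complex.exp z)) := by
    rw [Complex.exp_eq_exp_ℂ]
    exact NormedSpace.expSeries_div_hasSum_exp _
  have h2 := (h.mul_left (Complex.exp (-r))).tsum_eq
  rw [← Complex.exp_add] at h2
  rw [show (r : ℂ) * (Complex.exp z - 1) = -r + r * Complex.exp z by ring, ← h2]
  refine tsum_congr fun n => ?_
  rw [Complex.real_smul]
  push_cast
  rw [mul_pow, ← Complex.exp_nat_mul, mul_comm z]
  ring

/-! ### Law of the counts and the intensity measure -/

namespace IsPoissonPoints

variable {Ω : Type*} [MeasurableSpace Ω] {r : ℝ≥0} {T : ℕ → Ω → ℝ} {P : Measure Ω}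
  [IsProbabilityMeasure P]

/-- `count_law` only speaks of finite values. The mass at `⊤` is then forced, because both sides are
probability measures. -/
lemma map_pointCount (hT : IsPoissonPoints r T P) {B : Set ℝ} (hB : MeasurableSet B)
    (hB0 : B ⊆ Ioi 0) (hBv : volume B < ⊤) :
    P.map (fun ω => pointCount (fun j => T j ω) B) =
      (poissonMeasure (r * (volume B).toNNReal)).map ((↑) : ℕ → ℕ∞) := by
  have hm := measurable_pointCount hT.measurable hB
  have : IsProbabilityMeasure (P.map fun ω => pointCount (fun j => T j ω) B) :=
    Measure.isProbabilityMeasure_map hm.aemeasurable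
  set μ := P.map fun ω => pointCount (fun j => T j ω) B
  set ν := (poissonMeasure (r * (volume B).toNNReal)).map ((↑) : ℕ → ℕ∞)
  have hfin : ∀ n : ℕ, μ {(n : ℕ∞)} = ν {(n : ℕ∞)} := by
    intro n
    rw [Measure.map_apply hm (measurableSet_singleton _),
      Measure.map_apply (by fun_prop) (measurableSet_singleton _)]
    have : ((↑) : ℕ → ℕ∞) ⁻¹' {(n : ℕ∞)} = {n} := by ext; simp
    rw [this]
    exact hT.count_law B hB hB0 hBv n
  have htop : ∀ ρ : Measure ℕ∞, ρ (range ((↑) : ℕ → ℕ∞)) = ∑' n : ℕ, ρ {(n : ℕ∞)} := by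
    intro ρ
    rw [← iUnion_singleton_eq_range, measure_iUnion]
    · intro i j hij
      simpa using hij
    · intro i; exact measurableSet_singleton _
  have hcompl : ({⊤} : Set ℕ∞) = (range ((↑) : ℕ → ℕ∞))ᶜ := by
    ext k
    induction k using ENat.recTopCoe <;> simp
  refine Measure.ext_of_singleton fun k => ?_
  induction k using ENat.recTopCoe with
  | top =>
    rw [hcompl, prob_compl_eq_one_sub .of_discrete, prob_compl_eq_one_sub .of_discrete, htop,
      htop]
    simp_rw [hfin]
  | coe n => exact hfin n

lemma ae_pointCount_ne_top (hT : IsPoissonPoints r T P) {B : Set ℝ} (hB : MeasurableSet B)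
    (hB0 : B ⊆ Ioi 0) (hBv : volume B < ⊤) :
    ∀ᵐ ω ∂P, pointCount (fun j => T j ω) B ≠ ⊤ := by
  have hm := measurable_pointCount hT.measurable hB
  have h : ∀ᵐ k ∂(P.map fun ω => pointCount (fun j => T j ω) B), k ≠ ⊤ := by
    rw [hT.map_pointCount hB hB0 hBv, ae_map_iff (by fun_prop) .of_discrete]
    simp
  exact ae_of_ae_map hm.aemeasurable h

lemma integral_comp_pointCount (hT : IsPoissonPoints r T P) {B : Set ℝ} (hB : MeasurableSet B)
    (hB0 : B ⊆ Ioi 0) (hBv : volume B < ⊤) (g : ℕ → ℂ) :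
    ∫ ω, g (pointCount (fun j => T j ω) B).toNat ∂P =
      ∫ n, g n ∂poissonMeasure (r * (volume B).toNNReal) := by
  have hm := measurable_pointCount hT.measurable hB
  rw [← integral_map (φ := fun ω => pointCount (fun j => T j ω) B) (f := fun k => g k.toNat)
    hm.aemeasurable .of_discrete, hT.map_pointCount hB hB0 hBv,
    integral_map (by fun_prop) .of_discrete]
  simp

lemma lintegral_pointCount (hT : IsPoissonPoints r T P) {B : Set ℝ} (hB : MeasurableSet B)
    (hB0 : B ⊆ Ioi 0) (hBv : volume B < ⊤) :
    ∫⁻ ω, (pointCount (fun j => T j ω) B : ℝ≥0∞) ∂P = r * volume B := by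
  have hm := measurable_pointCount hT.measurable hB
  rw [← lintegral_map (g := fun ω => pointCount (fun j => T j ω) B)
    (f := fun k : ℕ∞ => (k : ℝ≥0∞)) .of_discrete hm, hT.map_pointCount hB hB0 hBv,
    lintegral_map .of_discrete (by fun_prop)]
  simp only [ENat.toENNReal_coe]
  rw [lintegral_natCast_poissonMeasure]
  push_cast
  rw [ENNReal.coe_toNNReal hBv.ne]

/-- Functions of the numbers of points in disjoint sets are independent. -/
lemma integral_prod_pointCount (hT : IsPoissonPoints r T P) {ι : Type*} [Fintype ι]
    {B : ι → Set ℝ} (hB : ∀ i, MeasurableSet (B i)) (hB0 : ∀ i, B i ⊆ Ioi 0)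
    (hBv : ∀ i, volume (B i) < ⊤) (hd : Pairwise fun i k => Disjoint (B i) (B k))
    (g : ι → ℕ → ℂ) :
    ∫ ω, ∏ i, g i (pointCount (fun j => T j ω) (B i)).toNat ∂P =
      ∏ i, ∫ n, g i n ∂poissonMeasure (r * (volume (B i)).toNNReal) := by
  let e := Fintype.equivFin ι
  have h := hT.count_indep (Fintype.card ι) (fun k => B (e.symm k)) (fun k => hB _)
    (fun k => hB0 _) (fun i k hik => hd (e.symm.injective.ne hik))
  have h' : iIndepFun (fun i ω => pointCount (fun j => T j ω) (B i)) P := by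
    simpa using h.precomp e.injective
  rw [h'.integral_fun_prod_comp (f := fun i k => g i k.toNat)
    (fun i => (measurable_pointCount hT.measurable (hB i)).aemeasurable) fun i => .of_discrete]
  exact Finset.prod_congr rfl fun i _ => hT.integral_comp_pointCount (hB i) (hB0 i) (hBv i) (g i)

lemma tsum_measure_preimage (hT : IsPoissonPoints r T P) {B : Set ℝ} (hB : MeasurableSet B)
    (hB0 : B ⊆ Ioi 0) (hBv : volume B < ⊤) :
    ∑' j, P (T j ⁻¹' B) = r * volume B := by
  rw [← hT.lintegral_pointCount hB hB0 hBv]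
  have h : ∀ ω, (pointCount (fun j => T j ω) B : ℝ≥0∞) =
      ∑' j, (T j ⁻¹' B).indicator (fun _ => 1) ω := by
    intro ω
    rw [pointCount, ← ENNReal.tsum_set_one, tsum_subtype {j | T j ω ∈ B} fun _ => 1]
    rfl
  simp_rw [h]
  rw [lintegral_tsum fun j => (measurable_const.indicator (hT.measurable j hB)).aemeasurable]
  refine tsum_congr fun j => ?_
  rw [lintegral_indicator (hT.measurable j hB)]
  simp

/-- The intensity measure of a Poisson process on the half-line. -/
lemma restrict_sum_map (hT : IsPoissonPoints r T P) :
    (Measure.sum fun j => P.map (T j)).restrict (Ioi 0) = r • volume.restrict (Ioi 0) := by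
  -- The count law needs sets of finite volume, so the half-line is exhausted by bounded pieces.
  have hU : ⋃ n : ℕ, Iic (n : ℝ) = univ := by
    ext x
    simpa using exists_nat_ge x
  refine Measure.ext_of_iUnion_eq_univ hU fun n => ?_
  ext s hs
  have hm : MeasurableSet (s ∩ Iic (n : ℝ) ∩ Ioi 0) :=
    (hs.inter measurableSet_Iic).inter measurableSet_Ioi
  have hv : volume (s ∩ Iic (n : ℝ) ∩ Ioi 0) < ⊤ := by
    refine (measure_mono (t := Ioc 0 (n : ℝ)) ?_).trans_lt measure_Ioc_lt_top
    rintro x ⟨⟨-, hx⟩, hx0⟩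
    exact ⟨hx0, hx⟩
  rw [Measure.restrict_apply hs, Measure.restrict_apply hs,
    Measure.restrict_apply (hs.inter measurableSet_Iic), Measure.sum_apply _ hm,
    Measure.smul_apply, Measure.restrict_apply (hs.inter measurableSet_Iic)]
  simp_rw [fun j => Measure.map_apply (μ := P) (hT.measurable j) hm]
  rw [hT.tsum_measure_preimage hm inter_subset_right hv]
  rfl

/-- The expected value of the sum is `r ∫ f`, which is finite. -/
lemma ae_summable (hT : IsPoissonPoints r T P) {f : ℝ → ℝ≥0} (hf : Measurable f)
    (hf0 : Function.support f ⊆ Ioi 0) (hfi : ∫⁻ x in Ioi 0, f x ≠ ⊤) :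
    ∀ᵐ ω ∂P, Summable fun j => f (T j ω) := by
  refine summable_of_lintegral_tsum_ne_top (fun j => hf.comp (hT.measurable j)) ?_
  have h : ∀ j, ∫⁻ ω, f (T j ω) ∂P = ∫⁻ x, f x ∂P.map (T j) := fun j =>
    (lintegral_map hf.coe_nnreal_ennreal (hT.measurable j)).symm
  simp_rw [h]
  rw [← lintegral_sum_measure, ← setLIntegral_eq_of_support_subset (s := Ioi 0),
    hT.restrict_sum_map, lintegral_smul_measure]
  · exact ENNReal.mul_ne_top ENNReal.coe_ne_top hfi
  · intro x hx
    exact hf0 (by simpa using hx)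

end IsPoissonPoints

/-! ### Campbell's formula -/

/-- The level set of the value `0` is left out: it may have infinite volume, hence contain
infinitely many points. -/
lemma MeasureTheory.SimpleFunc.comp_eq_sum_indicator {E : Type*} [AddCommMonoid E]
    (φ : SimpleFunc ℝ ℝ≥0) (g : ℝ≥0 → E) (hg : g 0 = 0) (x : ℝ) :
    g (φ x) = ∑ v ∈ φ.range.filter (· ≠ 0), (φ ⁻¹' {v}).indicator (fun _ => g v) x := by
  by_cases hx : φ x = 0
  · rw [hx, hg]
    refine (Finset.sum_eq_zero fun v hv => ?_).symm
    rw [indicator_of_notMem]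
    rintro (rfl : φ x = v)
    exact (Finset.mem_filter.1 hv).2 hx
  · rw [Finset.sum_eq_single (φ x)]
    · rw [indicator_of_mem (by simp)]
    · intro v _ hv
      rw [indicator_of_notMem]
      exact fun h => hv (Eq.symm h)
    · intro h
      exact absurd (Finset.mem_filter.2 ⟨φ.mem_range_self x, hx⟩) h

lemma hasSum_simpleFunc_comp (φ : SimpleFunc ℝ ℝ≥0) (x : ℕ → ℝ)
    (h : ∀ v ∈ φ.range.filter (· ≠ 0), pointCount x (φ ⁻¹' {v}) ≠ ⊤) :
    HasSum (fun j => (φ (x j) : ℝ))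
      (∑ v ∈ φ.range.filter (· ≠ 0), ((pointCount x (φ ⁻¹' {v})).toNat * v : ℝ)) := by
  have hj : ∀ j, (φ (x j) : ℝ) = ∑ v ∈ φ.range.filter (· ≠ 0),
      (φ ⁻¹' {v}).indicator (fun _ => (v : ℝ)) (x j) := fun j =>
    φ.comp_eq_sum_indicator (fun v => (v : ℝ)) rfl (x j)
  simp_rw [hj]
  refine hasSum_sum fun v hv => ?_
  have hfin : {j | x j ∈ φ ⁻¹' {v}}.Finite := Set.encard_ne_top_iff.1 (h v hv)
  have hcard : (pointCount x (φ ⁻¹' {v})).toNat = hfin.toFinset.card := by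
    rw [pointCount, hfin.encard_eq_coe_toFinset_card]
    rfl
  rw [hcard, ← nsmul_eq_mul, ← Finset.sum_const]
  have hs : ∑ _j ∈ hfin.toFinset, (v : ℝ) =
      ∑ j ∈ hfin.toFinset, (φ ⁻¹' {v}).indicator (fun _ => (v : ℝ)) (x j) := by
    refine Finset.sum_congr rfl fun j hj => ?_
    rw [indicator_of_mem (by simpa using hj)]
  rw [hs]
  refine hasSum_sum_of_ne_finset_zero fun j hj => ?_
  rw [indicator_of_notMem (by simpa using hj)]

/-- Mean value inequality on the half-plane `Re u ≤ 0`, which is convex and on which the derivative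
of `exp` has norm at most `1`. -/
lemma Complex.norm_exp_sub_one_le_of_re_nonpos {w : ℂ} (hw : w.re ≤ 0) :
    ‖Complex.exp w - 1‖ ≤ ‖w‖ := by
  have hconv : Convex ℝ {u : ℂ | u.re ≤ 0} := convex_halfSpace_re_le 0
  have h := hconv.norm_image_sub_le_of_norm_hasDerivWithin_le (f := Complex.exp)
    (f' := Complex.exp) (C := 1) (x := 0) (y := w)
    (fun u _ => (Complex.hasDerivAt_exp u).hasDerivWithinAt)
    (fun u hu => by
      rw [Complex.norm_exp]
      exact Real.exp_le_one_iff.2 hu) (by simp) hw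
  simpa using h

namespace IsPoissonPoints

variable {Ω : Type*} [MeasurableSpace Ω] {r : ℝ≥0} {T : ℕ → Ω → ℝ} {P : Measure Ω}
  [IsProbabilityMeasure P]

/-- For a simple function the sum over the points is `∑ v * N_v`, with `N_v` the independent Poisson
counts of the level sets. The exponential factorises, and each factor is a Poisson generating
function. -/
lemma setIntegral_exp_tsum_simpleFunc (hT : IsPoissonPoints r T P) {B : Set ℝ}
    (hB : MeasurableSet B) (hB0 : B ⊆ Ioi 0) (hBv : volume B < ⊤) (φ : SimpleFunc ℝ ℝ≥0)
    (hφ : Function.support φ ⊆ Ioi 0 \ B) (hφv : volume (Function.support φ) < ⊤) (z : ℂ) :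
    ∫ ω in {ω | pointCount (fun j => T j ω) B = 0}, Complex.exp (z * ∑' j, (φ (T j ω) : ℝ)) ∂P =
      Complex.exp (-(r * volume.real B)) *
        Complex.exp (r * ∫ x, (Complex.exp (z * (φ x : ℝ)) - 1)) := by
  classical
  set R := φ.range.filter (· ≠ 0) with hR
  have hsupp : ∀ v ∈ R, φ ⁻¹' {v} ⊆ Function.support φ := by
    rintro v hv x (rfl : φ x = v)
    exact (Finset.mem_filter.1 hv).2
  have hvol : ∀ v ∈ R, volume (φ ⁻¹' {v}) < ⊤ := fun v hv =>
    (measure_mono (hsupp v hv)).trans_lt hφv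
  have hpos : ∀ v ∈ R, φ ⁻¹' {v} ⊆ Ioi 0 := fun v hv =>
    (hsupp v hv).trans (hφ.trans sdiff_subset)
  have hint : ∫ x, (Complex.exp (z * (φ x : ℝ)) - 1) =
      ∑ v ∈ R, volume.real (φ ⁻¹' {v}) * (Complex.exp (z * (v : ℝ)) - 1) := by
    have h : ∀ x, Complex.exp (z * (φ x : ℝ)) - 1 = ∑ v ∈ R,
        (φ ⁻¹' {v}).indicator (fun _ => Complex.exp (z * (v : ℝ)) - 1) x := fun x =>
      φ.comp_eq_sum_indicator (fun v => Complex.exp (z * (v : ℝ)) - 1) (by simp) x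
    simp_rw [h]
    rw [integral_finsetSum]
    · refine Finset.sum_congr rfl fun v hv => ?_
      rw [integral_indicator_const _ (φ.measurableSet_fiber v), Complex.real_smul]
    · intro v hv
      exact (integrable_indicator_iff (φ.measurableSet_fiber v)).2
        (integrableOn_const (hvol v hv).ne)
  -- The event that `B` is empty joins the independent family as the factor at `none`, through the
  -- indicator of `n = 0`; its mean is `exp (-r |B|)`.
  let B' : Option R → Set ℝ := fun o => o.elim B fun v => φ ⁻¹' {(v : ℝ≥0)}
  let g : Option R → ℕ → ℂ := fun o => o.elim (fun n => if n = 0 then 1 else 0)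
    fun v n => Complex.exp (z * (v : ℝ≥0) * n)
  have key := hT.integral_prod_pointCount (B := B')
    (by rintro (_ | v); exacts [hB, φ.measurableSet_fiber _])
    (by rintro (_ | v); exacts [hB0, hpos v v.2])
    (by rintro (_ | v); exacts [hBv, hvol v v.2])
    (by
      rintro (_ | v) (_ | w) hvw
      · exact absurd rfl hvw
      · exact (disjoint_sdiff_right.mono_right ((hsupp w w.2).trans hφ))
      · exact (disjoint_sdiff_right.mono_right ((hsupp v v.2).trans hφ)).symm
      · exact Disjoint.preimage _ (disjoint_singleton.2 fun h =>
          hvw (congrArg some (Subtype.ext h)))) g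
  rw [Fintype.prod_option] at key
  simp only [Fintype.prod_option, B', g, Option.elim, integral_exp_mul_poissonMeasure] at key
  have hzero : ∫ n : ℕ, (if n = 0 then (1 : ℂ) else 0)
      ∂poissonMeasure (r * (volume B).toNNReal) = Complex.exp (-(r * volume.real B)) := by
    rw [integral_poissonMeasure, tsum_eq_single 0 (by simp +contextual)]
    simp [measureReal_def, ENNReal.toReal]
  rw [hzero] at key
  rw [hint, Finset.mul_sum, Complex.exp_sum, ← Finset.prod_coe_sort]
  convert key using 1
  · have hmeas : MeasurableSet {ω | pointCount (fun j => T j ω) B = 0} :=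
      measurable_pointCount hT.measurable hB (measurableSet_singleton 0)
    rw [← integral_indicator hmeas]
    refine integral_congr_ae ?_
    have hfin : ∀ᵐ ω ∂P, ∀ v ∈ R, pointCount (fun j => T j ω) (φ ⁻¹' {v}) ≠ ⊤ :=
      (Finset.eventually_all R).2 fun v hv =>
        hT.ae_pointCount_ne_top (φ.measurableSet_fiber v) (hpos v hv) (hvol v hv)
    filter_upwards [hfin, hT.ae_pointCount_ne_top hB hB0 hBv] with ω hω hω0
    by_cases h0 : pointCount (fun j => T j ω) B = 0
    · rw [indicator_of_mem (by exact h0), h0,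
        (hasSum_simpleFunc_comp φ (fun j => T j ω) hω).tsum_eq]
      rw [Finset.prod_coe_sort R fun v =>
        Complex.exp (z * (v : ℝ≥0) * (pointCount (fun j => T j ω) (φ ⁻¹' {v})).toNat),
        ← Complex.exp_sum]
      simp only [ENat.toNat_zero, if_true, one_mul]
      push_cast
      rw [Finset.mul_sum]
      congr 1
      exact Finset.sum_congr rfl fun v _ => by ring
    · rw [indicator_of_notMem (by exact h0), if_neg, zero_mul]
      rw [ENat.toNat_eq_zero]
      tauto
  · congr 1
    refine Finset.prod_congr rfl fun v _ => ?_
    congr 1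
    rw [measureReal_def, ENNReal.toReal]
    push_cast
    ring

/-- **Campbell's formula** for a Poisson process on the half-line: the Laplace transform of a sum
over the points that lie outside `B`, restricted to the event that `B` contains no point. -/
theorem setIntegral_exp_tsum (hT : IsPoissonPoints r T P) {B : Set ℝ}
    (hB : MeasurableSet B) (hB0 : B ⊆ Ioi 0) (hBv : volume B < ⊤) {f : ℝ → ℝ≥0}
    (hf : Measurable f) (hf0 : Function.support f ⊆ Ioi 0 \ B) (hfi : ∫⁻ x, f x ≠ ⊤)
    {z : ℂ} (hz : z.re ≤ 0) :
    ∫ ω in {ω | pointCount (fun j => T j ω) B = 0}, Complex.exp (z * ∑' j, (f (T j ω) : ℝ)) ∂P =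
      Complex.exp (-(r * volume.real B)) *
        Complex.exp (r * ∫ x, (Complex.exp (z * (f x : ℝ)) - 1)) := by
  set F : ℝ → ℝ≥0∞ := fun x => f x with hF
  have hFm : Measurable F := hf.coe_nnreal_ennreal
  -- Approximate `f` from below by simple functions and pass to the limit on both sides by dominated
  -- convergence. As `Re z ≤ 0`, the bounds are `1` on the probability side and `‖z‖ * f` in the
  -- exponent.
  let φ : ℕ → SimpleFunc ℝ ℝ≥0 := fun n => (SimpleFunc.eapprox F n).map ENNReal.toNNReal
  have hφF : ∀ n x, ((φ n x : ℝ≥0) : ℝ≥0∞) = SimpleFunc.eapprox F n x := fun n x =>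
    ENNReal.coe_toNNReal (SimpleFunc.eapprox_lt_top F n x).ne
  have hle : ∀ n x, φ n x ≤ f x := by
    intro n x
    have h : SimpleFunc.eapprox F n x ≤ F x := by
      rw [← SimpleFunc.iSup_eapprox_apply hFm x]
      exact le_iSup (fun k => SimpleFunc.eapprox F k x) n
    rw [← hφF] at h
    exact ENNReal.coe_le_coe.1 h
  have hlim : ∀ x, Tendsto (fun n => φ n x) atTop (𝓝 (f x)) := by
    intro x
    have h := SimpleFunc.tendsto_eapprox hFm x
    simp_rw [← hφF] at h
    exact ENNReal.tendsto_coe.1 h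
  have hsub : ∀ n, Function.support (φ n) ⊆ Function.support f := by
    intro n x hx hfx
    have := hle n x
    rw [hfx] at this
    exact hx (nonpos_iff_eq_zero.1 this)
  have hvol : ∀ n, volume (Function.support (φ n)) < ⊤ := by
    intro n
    refine (measure_mono ?_).trans_lt (SimpleFunc.measure_support_lt_top_of_lintegral_ne_top
      (f := SimpleFunc.eapprox F n) (μ := volume) ?_)
    · intro x hx h0
      refine hx ?_
      have := hφF n x
      rw [h0] at this
      exact_mod_cast this
    · rw [← SimpleFunc.lintegral_eq_lintegral]
      refine ne_top_of_le_ne_top hfi (lintegral_mono fun x => ?_)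
      rw [← hφF]
      exact ENNReal.coe_le_coe.2 (hle n x)
  have hsimple := fun n => hT.setIntegral_exp_tsum_simpleFunc hB hB0 hBv (φ n)
    ((hsub n).trans hf0) (hvol n) z
  have hfint : Integrable (fun x => (f x : ℝ)) := by
    refine ⟨hf.coe_nnreal_real.aestronglyMeasurable, ?_⟩
    simpa [HasFiniteIntegral, hF] using hfi.lt_top
  have hsummable : ∀ᵐ ω ∂P, Summable fun j => f (T j ω) := by
    refine hT.ae_summable hf (hf0.trans sdiff_subset) ?_
    exact ne_top_of_le_ne_top hfi (setLIntegral_le_lintegral _ _)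
  have hL : Tendsto (fun n => ∫ ω in {ω | pointCount (fun j => T j ω) B = 0},
      Complex.exp (z * ∑' j, (φ n (T j ω) : ℝ)) ∂P) atTop
      (𝓝 (∫ ω in {ω | pointCount (fun j => T j ω) B = 0},
        Complex.exp (z * ∑' j, (f (T j ω) : ℝ)) ∂P)) := by
    refine tendsto_integral_of_dominated_convergence (fun _ => 1) ?_ (integrable_const _) ?_ ?_
    · intro n
      have hm : ∀ j, Measurable fun ω => (φ n (T j ω) : ℝ) := fun j =>
        ((φ n).measurable.comp (hT.measurable j)).coe_nnreal_real
      exact (by fun_prop : Measurable fun ω =>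
        Complex.exp (z * ∑' j, (φ n (T j ω) : ℝ))).aestronglyMeasurable
    · refine fun n => ae_of_all _ fun ω => ?_
      rw [Complex.norm_exp]
      refine Real.exp_le_one_iff.2 ?_
      rw [Complex.re_mul_ofReal]
      exact mul_nonpos_of_nonpos_of_nonneg hz (tsum_nonneg fun j => NNReal.coe_nonneg _)
    · filter_upwards [ae_restrict_of_ae hsummable] with ω hω
      refine (Complex.continuous_exp.tendsto _).comp (Tendsto.const_mul _
        ((Complex.continuous_ofReal.tendsto _).comp ?_))
      refine tendsto_tsum_of_dominated_convergence (bound := fun j => (f (T j ω) : ℝ))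
        (NNReal.summable_coe.2 hω) ?_ ?_
      · exact fun j => (NNReal.continuous_coe.tendsto _).comp (hlim (T j ω))
      · refine Eventually.of_forall fun n j => ?_
        simpa using hle n (T j ω)
  have hR : Tendsto (fun n => Complex.exp (-(r * volume.real B)) *
        Complex.exp (r * ∫ x, (Complex.exp (z * (φ n x : ℝ)) - 1))) atTop
      (𝓝 (Complex.exp (-(r * volume.real B)) *
        Complex.exp (r * ∫ x, (Complex.exp (z * (f x : ℝ)) - 1)))) := by
    refine Tendsto.const_mul _ ((Complex.continuous_exp.tendsto _).comp (Tendsto.const_mul _ ?_))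
    refine tendsto_integral_of_dominated_convergence (fun x => ‖z‖ * f x) ?_
      (hfint.const_mul _) ?_ ?_
    · intro n
      have hm : Measurable fun x => (φ n x : ℝ) := (φ n).measurable.coe_nnreal_real
      exact (by fun_prop : Measurable fun x =>
        Complex.exp (z * (φ n x : ℝ)) - 1).aestronglyMeasurable
    · refine fun n => ae_of_all _ fun x => ?_
      refine (Complex.norm_exp_sub_one_le_of_re_nonpos ?_).trans ?_
      · rw [Complex.re_mul_ofReal]
        exact mul_nonpos_of_nonpos_of_nonneg hz (NNReal.coe_nonneg _)
      · rw [norm_mul]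
        refine mul_le_mul_of_nonneg_left ?_ (norm_nonneg _)
        simpa using hle n x
    · refine ae_of_all _ fun x => ?_
      refine ((Complex.continuous_exp.tendsto _).comp (Tendsto.const_mul _ ?_)).sub_const _
      exact (Complex.continuous_ofReal.tendsto _).comp
          ((NNReal.continuous_coe.tendsto _).comp (hlim x))
  simp_rw [hsimple] at hL
  exact tendsto_nhds_unique hL hR

end IsPoissonPoints

/-! ### The first point, and convergence of power sums over the points -/

lemma pointCount_Ioc_zero_eq_zero_iff {x : ℕ → ℝ} (h0 : 0 < x 0) (hx : StrictMono x) (s : ℝ) :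
    pointCount x (Ioc 0 s) = 0 ↔ s < x 0 := by
  rw [pointCount, Set.encard_eq_zero, Set.eq_empty_iff_forall_notMem]
  constructor
  · intro h
    by_contra! hs
    exact h 0 ⟨h0, hs⟩
  · rintro h j ⟨-, hj⟩
    exact absurd (h.trans_le (hx.monotone (Nat.zero_le j))) (not_lt.2 hj)

/-- The exponent carries the factor `r`, so the result is free of `r`; this is where the intensity
of the process drops out. -/
lemma integral_exp_mul_expMeasure {r : ℝ} (hr : 0 < r) {z : ℂ} (hz : z.re ≤ 0) :
    ∫ t, Complex.exp (r * z * t) ∂expMeasure r = (1 - z)⁻¹ := by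
  have hm : Measurable (exponentialPDF r) :=
    (measurable_exponentialPDFReal r).ennreal_ofReal
  rw [show expMeasure r = volume.withDensity (exponentialPDF r) from rfl,
    integral_withDensity_eq_integral_toReal_smul hm (ae_of_all _ fun _ => ENNReal.ofReal_lt_top)]
  have h : ∀ t : ℝ, (exponentialPDF r t).toReal • Complex.exp (r * z * t) =
      (Ici 0).indicator (fun t : ℝ => r * Complex.exp (r * (z - 1) * t)) t := by
    intro t
    rw [exponentialPDF_eq]
    by_cases ht : 0 ≤ t
    · rw [if_pos ht, indicator_of_mem (by exact ht), ENNReal.toReal_ofReal (by positivity),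
        Complex.real_smul]
      push_cast
      rw [mul_assoc, ← Complex.exp_add]
      ring_nf
    · rw [if_neg ht, indicator_of_notMem (by exact ht)]
      simp
  simp_rw [h]
  have hne : (1 - z) ≠ 0 := by
    intro h
    have := congrArg Complex.re h
    simp at this
    linarith
  have hr' : (r : ℂ) ≠ 0 := by exact_mod_cast hr.ne'
  have hne' : z - 1 ≠ 0 := fun h => hne (by linear_combination -h)
  rw [integral_indicator measurableSet_Ici, integral_Ici_eq_integral_Ioi, integral_const_mul,
    integral_exp_mul_complex_Ioi]
  · field_simp
    simp
  · rw [Complex.re_ofReal_mul]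
    simp only [Complex.sub_re, Complex.one_re]
    nlinarith

namespace IsPoissonPoints

variable {Ω : Type*} [MeasurableSpace Ω] {r : ℝ≥0} {T : ℕ → Ω → ℝ} {P : Measure Ω}
  [IsProbabilityMeasure P]

omit [IsProbabilityMeasure P] in
lemma pointCount_Ioc_zero_ae (hT : IsPoissonPoints r T P) (s : ℝ) :
    {ω | pointCount (fun j => T j ω) (Ioc 0 s) = 0} =ᵐ[P] {ω | s < T 0 ω} := by
  filter_upwards [hT.pos, hT.strictMono] with ω h0 hω
  exact propext (pointCount_Ioc_zero_eq_zero_iff h0 hω s)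

omit [IsProbabilityMeasure P] in
lemma measureReal_lt_first (hT : IsPoissonPoints r T P) {s : ℝ} (hs : 0 ≤ s) :
    P.real {ω | s < T 0 ω} = Real.exp (-(r * s)) := by
  rw [← measureReal_congr (hT.pointCount_Ioc_zero_ae s), measureReal_def]
  have h := hT.count_law (Ioc 0 s) measurableSet_Ioc Ioc_subset_Ioi_self measure_Ioc_lt_top 0
  simp only [Nat.cast_zero] at h
  rw [h, ← measureReal_def, poissonMeasure_real_singleton]
  simp only [Real.volume_Ioc, sub_zero, ENNReal.coe_toNNReal_eq_toReal, pow_zero, mul_one,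
    Nat.factorial_zero, Nat.cast_one, div_one, NNReal.coe_mul, ENNReal.toReal_ofReal hs]

/-- The first point of a Poisson process is exponentially distributed. -/
lemma map_first (hT : IsPoissonPoints r T P) (hr : 0 < r) : P.map (T 0) = expMeasure r := by
  have := isProbabilityMeasure_expMeasure (r := r) (by exact_mod_cast hr)
  have : IsProbabilityMeasure (P.map (T 0)) :=
    Measure.isProbabilityMeasure_map (hT.measurable 0).aemeasurable
  refine Measure.eq_of_cdf _ _ (StieltjesFunction.ext fun x => ?_)
  rw [cdf_expMeasure_eq (by exact_mod_cast hr), cdf_eq_real,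
    map_measureReal_apply (hT.measurable 0) measurableSet_Iic]
  split_ifs with hx
  · rw [← hT.measureReal_lt_first hx, ← probReal_compl_eq_one_sub
      (measurableSet_lt measurable_const (hT.measurable 0))]
    congr 1
    ext ω
    simp
  · rw [measureReal_eq_zero_iff]
    refine measure_mono_null ?_ (ae_iff.1 hT.pos)
    intro ω (hω : T 0 ω ≤ x)
    simp only [mem_ofPred_eq, not_lt]
    linarith

lemma ae_eventually_lt (hT : IsPoissonPoints r T P) :
    ∀ᵐ ω ∂P, ∀ᶠ j in atTop, 1 < T j ω := by
  filter_upwards [hT.pos, hT.strictMono, hT.ae_pointCount_ne_top measurableSet_Ioc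
    (Ioc_subset_Ioi_self : Ioc (0 : ℝ) 1 ⊆ Ioi 0) measure_Ioc_lt_top] with ω h0 hω hfin
  have h := (Set.encard_ne_top_iff.1 hfin).eventually_cofinite_notMem
  rw [Nat.cofinite_eq_atTop] at h
  filter_upwards [h] with j hj
  by_contra! hj1
  exact hj ⟨h0.trans_le (hω.monotone (Nat.zero_le j)), hj1⟩

lemma ae_summable_rpow (hT : IsPoissonPoints r T P) :
    ∀ᵐ ω ∂P, ∀ p : ℝ, 1 < p → Summable fun j => T j ω ^ (-p) := by
  -- One null set must serve all `p > 1`, so only the countably many exponents `1 + 1/(n+1)` are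
  -- treated. Every `p > 1` exceeds one of them, and powers compare because eventually `T j > 1`.
  -- Cutting off at `1` makes the power integrable.
  have key : ∀ n : ℕ, ∀ᵐ ω ∂P, Summable fun j =>
      ((Ioi 1).indicator (fun x : ℝ => (x ^ (-(1 + 1 / ((n : ℝ) + 1)))).toNNReal) (T j ω)) := by
    intro n
    refine hT.ae_summable (f := (Ioi 1).indicator fun x : ℝ =>
      (x ^ (-(1 + 1 / ((n : ℝ) + 1)))).toNNReal) ?_ ?_ ?_
    · exact Measurable.indicator (by fun_prop) measurableSet_Ioi
    · exact (support_indicator_subset).trans (Ioi_subset_Ioi zero_le_one)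
    · have hi : IntegrableOn (fun x : ℝ => x ^ (-(1 + 1 / ((n : ℝ) + 1)))) (Ioi 1) :=
        integrableOn_Ioi_rpow_of_lt (by have : 0 < 1 / ((n : ℝ) + 1) := by positivity
                                        linarith) one_pos
      have h : ∀ x, (((Ioi 1).indicator (fun x : ℝ => (x ^ (-(1 + 1 / ((n : ℝ) + 1)))).toNNReal) x :
          ℝ≥0) : ℝ≥0∞) = (Ioi 1).indicator
            (fun x : ℝ => ENNReal.ofReal (x ^ (-(1 + 1 / ((n : ℝ) + 1))))) x := by
        intro x
        by_cases hx : x ∈ Ioi (1 : ℝ)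
        · rw [indicator_of_mem hx, indicator_of_mem hx]; rfl
        · rw [indicator_of_notMem hx, indicator_of_notMem hx]; rfl
      simp_rw [h]
      refine ne_top_of_le_ne_top ?_ (setLIntegral_le_lintegral _ _)
      rw [lintegral_indicator measurableSet_Ioi]
      refine (lt_of_le_of_lt (lintegral_mono fun x => ?_) hi.2).ne
      exact Real.ofReal_le_enorm _
  filter_upwards [ae_all_iff.2 key, hT.ae_eventually_lt] with ω hω hlt p hp
  obtain ⟨n, hn⟩ := exists_nat_one_div_lt (sub_pos.2 hp)
  refine Summable.of_norm_bounded_eventually_nat (NNReal.summable_coe.2 (hω n)) ?_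
  filter_upwards [hlt] with j hj
  rw [indicator_of_mem (by exact hj), Real.coe_toNNReal _ (by positivity),
    Real.norm_of_nonneg (by positivity)]
  exact Real.rpow_le_rpow_of_exponent_le hj.le (by linarith)

/-- Let `S_n` be the sum of the inverses of the points in `(1, n+1]`. Campbell's formula gives `E
exp (-S_n) ≤ (n+1)^(-r/2)`, which tends to `0`, so `inf_n exp (-S_n) = 0` almost surely. A
convergent sum of inverses would bound this infimum below by a positive number. -/
lemma ae_not_summable_inv (hT : IsPoissonPoints r T P) (hr : 0 < r) :
    ∀ᵐ ω ∂P, ¬ Summable fun j => (T j ω)⁻¹ := by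
  let f : ℕ → ℝ → ℝ≥0 := fun n => (Ioc 1 ((n : ℝ) + 1)).indicator fun x => (x⁻¹).toNNReal
  have hfm : ∀ n, Measurable (f n) := fun n =>
    Measurable.indicator (by fun_prop) measurableSet_Ioc
  have hcoe : ∀ n x, (f n x : ℝ) = (Ioc 1 ((n : ℝ) + 1)).indicator (fun x => x⁻¹) x := by
    intro n x
    by_cases hx : x ∈ Ioc 1 ((n : ℝ) + 1)
    · have : 0 < x := zero_lt_one.trans hx.1
      simp only [f, indicator_of_mem hx]
      exact Real.coe_toNNReal _ (by positivity)
    · simp only [f, indicator_of_notMem hx]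
      rfl
  have hfint : ∀ n, ∫⁻ x, f n x ≠ ⊤ := by
    intro n
    refine (lt_of_le_of_lt (lintegral_mono (g := (Ioc 1 ((n : ℝ) + 1)).indicator fun _ => 1)
      fun x => ?_) ?_).ne
    · by_cases hx : x ∈ Ioc 1 ((n : ℝ) + 1)
      · simp only [f, indicator_of_mem hx]
        have : x⁻¹ ≤ 1 := inv_le_one_of_one_le₀ hx.1.le
        exact_mod_cast Real.toNNReal_le_one.2 this
      · simp [f, indicator_of_notMem hx]
    · rw [lintegral_indicator measurableSet_Ioc]
      simp
  have hlap : ∀ n : ℕ, ∫ ω, Real.exp (-∑' j, (f n (T j ω) : ℝ)) ∂P ≤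
      Real.exp (-(r / 2 * Real.log ((n : ℝ) + 1))) := by
    intro n
    have h := hT.setIntegral_exp_tsum MeasurableSet.empty (empty_subset _) (by simp) (hfm n)
      (by rw [sdiff_empty]
          exact support_indicator_subset.trans
            (Ioc_subset_Ioi_self.trans (Ioi_subset_Ioi zero_le_one)))
      (hfint n) (z := -1) (by simp)
    have hu : {ω | pointCount (fun j => T j ω) ∅ = 0} = univ := by
      ext ω; simp [pointCount]
    rw [hu, Measure.restrict_univ] at h
    have h2 : ∫ ω, Real.exp (-∑' j, (f n (T j ω) : ℝ)) ∂P =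
        Real.exp (r * ∫ x, (Real.exp (-(f n x : ℝ)) - 1)) := by
      have hl : ∀ ω, Complex.exp (-1 * (∑' j, (f n (T j ω) : ℝ) : ℝ)) =
          (Real.exp (-∑' j, (f n (T j ω) : ℝ)) : ℂ) := by intro ω; push_cast; ring_nf
      have hr : ∀ x, Complex.exp (-1 * ((f n x : ℝ) : ℂ)) - 1 =
          ((Real.exp (-(f n x : ℝ)) - 1 : ℝ) : ℂ) := by intro x; push_cast; ring_nf
      simp_rw [hl, hr] at h
      rw [integral_complex_ofReal, integral_complex_ofReal] at h
      simp only [measureReal_empty, Complex.ofReal_zero, mul_zero, neg_zero, Complex.exp_zero,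
        one_mul] at h
      exact_mod_cast h
    rw [h2]
    refine Real.exp_le_exp.2 ?_
    have hind : ∀ x, Real.exp (-(f n x : ℝ)) - 1 =
        (Ioc 1 ((n : ℝ) + 1)).indicator (fun x => Real.exp (-x⁻¹) - 1) x := by
      intro x
      rw [hcoe]
      by_cases hx : x ∈ Ioc 1 ((n : ℝ) + 1)
      · simp only [indicator_of_mem hx]
      · simp [indicator_of_notMem hx]
    simp_rw [hind]
    rw [integral_indicator measurableSet_Ioc]
    have hle : (1 : ℝ) ≤ (n : ℝ) + 1 := by linarith [(Nat.cast_nonneg n : (0 : ℝ) ≤ n)]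
    have hlog : ∫ x in Ioc 1 ((n : ℝ) + 1), -(1 / 2) * x⁻¹ = -(1 / 2) * Real.log ((n : ℝ) + 1) := by
      rw [← intervalIntegral.integral_of_le hle, intervalIntegral.integral_const_mul,
        integral_inv_of_pos one_pos (by linarith), div_one]
    -- For `0 ≤ u ≤ 1` one has `exp (-u) ≤ 1/(1+u) ≤ 1 - u/2`, applied to `u = 1/x`.
    have hmono : ∫ x in Ioc 1 ((n : ℝ) + 1), (Real.exp (-x⁻¹) - 1) ≤
        ∫ x in Ioc 1 ((n : ℝ) + 1), -(1 / 2) * x⁻¹ := by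
      have hc : ContinuousOn (fun x : ℝ => x⁻¹) (Icc 1 ((n : ℝ) + 1)) :=
        continuousOn_inv₀.mono fun x hx => (zero_lt_one.trans_le hx.1).ne'
      refine setIntegral_mono_on ?_ ?_ measurableSet_Ioc ?_
      · exact ((hc.neg.rexp.sub continuousOn_const).integrableOn_compact isCompact_Icc).mono_set
          Ioc_subset_Icc_self
      · exact ((continuousOn_const.mul hc).integrableOn_compact isCompact_Icc).mono_set
          Ioc_subset_Icc_self
      · intro x hx
        have hx0 : 0 < x := zero_lt_one.trans hx.1
        have hu0 : 0 < x⁻¹ := inv_pos.2 hx0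
        have hu1 : x⁻¹ ≤ 1 := inv_le_one_of_one_le₀ hx.1.le
        have h1 : Real.exp (-x⁻¹) ≤ (1 + x⁻¹)⁻¹ := by
          rw [Real.exp_neg]
          exact inv_anti₀ (by positivity) (by linarith [Real.add_one_le_exp x⁻¹])
        have h2 : (1 + x⁻¹)⁻¹ ≤ 1 - x⁻¹ / 2 := by
          rw [inv_le_iff_one_le_mul₀ (by positivity)]
          nlinarith
        linarith
    have hr0 : (0 : ℝ) ≤ r := r.coe_nonneg
    calc (r : ℝ) * ∫ x in Ioc 1 ((n : ℝ) + 1), (Real.exp (-x⁻¹) - 1)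
        ≤ r * (-(1 / 2) * Real.log ((n : ℝ) + 1)) := by
          rw [← hlog]; exact mul_le_mul_of_nonneg_left hmono hr0
      _ = _ := by ring
  have hlim : Tendsto (fun n : ℕ => ENNReal.ofReal
      (Real.exp (-(r / 2 * Real.log ((n : ℝ) + 1))))) atTop (𝓝 0) := by
    rw [← ENNReal.ofReal_zero]
    refine (ENNReal.continuous_ofReal.tendsto _).comp (Real.tendsto_exp_neg_atTop_nhds_zero.comp ?_)
    refine Tendsto.const_mul_atTop (by positivity) (Real.tendsto_log_atTop.comp ?_)
    exact tendsto_atTop_add_const_right _ _ tendsto_natCast_atTop_atTop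
  have hXm : ∀ n, Measurable fun ω => ENNReal.ofReal (Real.exp (-∑' j, (f n (T j ω) : ℝ))) := by
    intro n
    have hm : ∀ j, Measurable fun ω => (f n (T j ω) : ℝ) := fun j =>
      ((hfm n).comp (hT.measurable j)).coe_nnreal_real
    fun_prop
  have hinf : ∫⁻ ω, ⨅ n, ENNReal.ofReal (Real.exp (-∑' j, (f n (T j ω) : ℝ))) ∂P = 0 := by
    refine le_antisymm (ge_of_tendsto' hlim fun n => ?_) zero_le
    refine (lintegral_mono fun ω => iInf_le _ n).trans ?_
    rw [← ofReal_integral_eq_lintegral_ofReal]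
    · exact ENNReal.ofReal_le_ofReal (hlap n)
    · refine Integrable.of_bound (C := 1) ?_ (ae_of_all _ fun ω => ?_)
      · have hm : ∀ j, Measurable fun ω => (f n (T j ω) : ℝ) := fun j =>
          ((hfm n).comp (hT.measurable j)).coe_nnreal_real
        exact (by fun_prop : Measurable fun ω =>
          Real.exp (-∑' j, (f n (T j ω) : ℝ))).aestronglyMeasurable
      · rw [Real.norm_of_nonneg (Real.exp_pos _).le, Real.exp_le_one_iff, neg_nonpos]
        exact tsum_nonneg fun j => NNReal.coe_nonneg _
    · exact ae_of_all _ fun ω => (Real.exp_pos _).le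
  rw [lintegral_eq_zero_iff (Measurable.iInf hXm)] at hinf
  filter_upwards [hinf, hT.pos, hT.strictMono] with ω hω h0 hmono hs
  have hpos : ∀ j, 0 < T j ω := fun j => h0.trans_le (hmono.monotone (Nat.zero_le j))
  have hge : ENNReal.ofReal (Real.exp (-∑' j, (T j ω)⁻¹)) ≤
      ⨅ n, ENNReal.ofReal (Real.exp (-∑' j, (f n (T j ω) : ℝ))) := by
    refine le_iInf fun n => ENNReal.ofReal_le_ofReal (Real.exp_le_exp.2 (neg_le_neg ?_))
    have hle : ∀ j, (f n (T j ω) : ℝ) ≤ (T j ω)⁻¹ := fun j => by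
      rw [hcoe]
      exact indicator_le_self' (fun _ _ => (inv_pos.2 (hpos j)).le) _
    exact Summable.tsum_le_tsum hle
      (Summable.of_nonneg_of_le (fun j => NNReal.coe_nonneg _) hle hs) hs
  rw [hω] at hge
  simp only [Pi.zero_apply, nonpos_iff_eq_zero, ENNReal.ofReal_eq_zero] at hge
  exact absurd hge (not_le.2 (Real.exp_pos _))

end IsPoissonPoints

/-! ### The characteristic function of the ratio sum -/

/-- The integral `∫₁^∞ (exp (i ξ v⁻ᵖ) - 1) dv`, which governs the contribution of the later points
of a Poisson process when its first point is rescaled to `1`. -/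
noncomputable def laterPointsExponent (p ξ : ℝ) : ℂ :=
  ∫ v in Ioi (1 : ℝ), (Complex.exp ((ξ * v ^ (-p) : ℝ) * Complex.I) - 1)

lemma re_laterPointsExponent_integrand_nonpos (x : ℝ) :
    (Complex.exp (x * Complex.I) - 1).re ≤ 0 := by
  rw [Complex.sub_re, Complex.exp_ofReal_mul_I_re, Complex.one_re]
  linarith [Real.cos_le_one x]

lemma norm_exp_ofReal_mul_I_sub_one_le (x : ℝ) : ‖Complex.exp (x * Complex.I) - 1‖ ≤ |x| := by
  refine (Complex.norm_exp_sub_one_le_of_re_nonpos (by simp)).trans ?_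
  simp

lemma integrableOn_laterPointsExponent {p : ℝ} (hp : 1 < p) (ξ : ℝ) :
    IntegrableOn (fun v : ℝ => Complex.exp ((ξ * v ^ (-p) : ℝ) * Complex.I) - 1) (Ioi 1) := by
  have hi : IntegrableOn (fun v : ℝ => |ξ| * v ^ (-p)) (Ioi 1) :=
    (integrableOn_Ioi_rpow_of_lt (by linarith) one_pos).const_mul _
  refine Integrable.mono' hi (by fun_prop) ?_
  filter_upwards [ae_restrict_mem measurableSet_Ioi] with v hv
  refine (norm_exp_ofReal_mul_I_sub_one_le _).trans ?_
  have : 0 < v := zero_lt_one.trans hv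
  rw [abs_mul, abs_of_pos (Real.rpow_pos_of_pos this _)]

/-- The real part of the integrand is `cos - 1`. This sign bounds the exponentials below by norm `1`
and keeps `1 - Ψ` away from `0`. -/
lemma re_laterPointsExponent_nonpos {p : ℝ} (hp : 1 < p) (ξ : ℝ) :
    (laterPointsExponent p ξ).re ≤ 0 := by
  rw [laterPointsExponent, ← Complex.reCLM_apply,
    ← Complex.reCLM.integral_comp_comm (integrableOn_laterPointsExponent hp ξ)]
  exact integral_nonpos fun v => re_laterPointsExponent_integrand_nonpos _

lemma re_mul_laterPointsExponent_nonpos {p : ℝ} (hp : 1 < p) (ξ : ℝ) {a u : ℝ} (ha : 0 ≤ a)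
    (hu : 0 ≤ u) : (a * laterPointsExponent p ξ * u).re ≤ 0 := by
  rw [Complex.re_mul_ofReal, Complex.re_ofReal_mul]
  exact mul_nonpos_of_nonpos_of_nonneg
    (mul_nonpos_of_nonneg_of_nonpos ha (re_laterPointsExponent_nonpos hp ξ)) hu

/-- Substitute `x = t v`. Linearity in `t` is what makes the average over an exponential first point
explicit. -/
lemma integral_Ioi_exp_rpow_sub_one {t : ℝ} (ht : 0 < t) (p ξ : ℝ) :
    ∫ x in Ioi t, (Complex.exp ((ξ * (t ^ p * x ^ (-p)) : ℝ) * Complex.I) - 1) =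
      t * laterPointsExponent p ξ := by
  have h := integral_comp_mul_left_Ioi
    (fun x => Complex.exp ((ξ * (t ^ p * x ^ (-p)) : ℝ) * Complex.I) - 1) 1 ht
  rw [mul_one] at h
  have h2 : ∫ x in Ioi (1 : ℝ), (Complex.exp ((ξ * (t ^ p * (t * x) ^ (-p)) : ℝ) * Complex.I) - 1) =
      laterPointsExponent p ξ := by
    refine setIntegral_congr_fun measurableSet_Ioi fun x hx => ?_
    have hx0 : (0 : ℝ) < x := zero_lt_one.trans hx
    have : t ^ p * (t * x) ^ (-p) = x ^ (-p) := by
      rw [Real.mul_rpow ht.le hx0.le, ← mul_assoc, ← Real.rpow_add ht]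
      simp
    simp only [this]
  rw [h2] at h
  rw [h, Complex.real_smul, ← mul_assoc, ← Complex.ofReal_mul, mul_inv_cancel₀ ht.ne']
  simp

/-- The sum of the `-p`-th powers of the points beyond `t`. -/
noncomputable def tailSum (p : ℝ) (x : ℕ → ℝ) (t : ℝ) : ℝ :=
  ∑' j, (Ioi t).indicator (fun u : ℝ => u ^ (-p)) (x j)

/-- Moving the threshold slightly to the right of the first point does not change the tail, so the
random threshold `T 0` can be replaced by a grid point above it. -/
lemma tailSum_eq_of_mem_Ico {x : ℕ → ℝ} (hx : StrictMono x) (p : ℝ) {t : ℝ}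
    (ht : t ∈ Ico (x 0) (x 1)) : tailSum p x t = ∑' j, x (j + 1) ^ (-p) := by
  rw [tailSum, ← (add_left_injective 1).tsum_eq]
  · refine tsum_congr fun k => ?_
    have hk : t < x (k + 1) := ht.2.trans_le (hx.monotone (by omega))
    rw [indicator_of_mem (by exact hk)]
  · rintro j hj
    obtain _ | k := j
    · rw [Function.mem_support, indicator_of_notMem (by simpa using ht.1)] at hj
      exact absurd rfl hj
    · exact ⟨k, rfl⟩

namespace IsPoissonPoints

variable {Ω : Type*} [MeasurableSpace Ω] {r : ℝ≥0} {T : ℕ → Ω → ℝ} {P : Measure Ω}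
  [IsProbabilityMeasure P]

omit [IsProbabilityMeasure P] in
lemma measurable_tailSum (hT : IsPoissonPoints r T P) (p : ℝ) {D : Ω → ℝ} (hD : Measurable D) :
    Measurable fun ω => tailSum p (fun j => T j ω) (D ω) := by
  have h : ∀ j, Measurable fun ω => (Ioi (D ω)).indicator (fun u : ℝ => u ^ (-p)) (T j ω) := by
    intro j
    have := hT.measurable j
    simp only [indicator_apply, mem_Ioi]
    exact Measurable.ite (measurableSet_lt hD this) (by fun_prop) measurable_const
  unfold tailSum
  fun_prop

/-- Up to a null set, `s < T 0` says that `(0, s]` is empty. As `s ≤ t`, this is independent of the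
points beyond `t`: Campbell's formula with `B = (0, s]`. -/
lemma setIntegral_lt_exp_tailSum (hT : IsPoissonPoints r T P) {p : ℝ} (hp : 1 < p) (ξ : ℝ)
    {s t : ℝ} (hs : 0 ≤ s) (hst : s ≤ t) (ht : 0 < t) :
    ∫ ω in {ω | s < T 0 ω},
        Complex.exp ((ξ * (t ^ p * tailSum p (fun j => T j ω) t) : ℝ) * Complex.I) ∂P =
      P.real {ω | s < T 0 ω} * Complex.exp (r * (t * laterPointsExponent p ξ)) := by
  let f : ℝ → ℝ≥0 := (Ioi t).indicator fun x => (x ^ (-p)).toNNReal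
  have hcoe : ∀ x, (f x : ℝ) = (Ioi t).indicator (fun x => x ^ (-p)) x := by
    intro x
    by_cases hx : x ∈ Ioi t
    · have : 0 < x := ht.trans hx
      simp only [f, indicator_of_mem hx]
      exact Real.coe_toNNReal _ (by positivity)
    · simp only [f, indicator_of_notMem hx]
      rfl
  have hfi : ∫⁻ x, f x ≠ ⊤ := by
    have hi : IntegrableOn (fun x : ℝ => x ^ (-p)) (Ioi t) :=
      integrableOn_Ioi_rpow_of_lt (by linarith) ht
    have h : ∀ x, (f x : ℝ≥0∞) = (Ioi t).indicator (fun x : ℝ => ENNReal.ofReal (x ^ (-p))) x := by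
      intro x
      by_cases hx : x ∈ Ioi t
      · simp only [f, indicator_of_mem hx]; rfl
      · simp only [f, indicator_of_notMem hx]; rfl
    simp_rw [h]
    rw [lintegral_indicator measurableSet_Ioi]
    refine (lt_of_le_of_lt (lintegral_mono fun x => ?_) hi.2).ne
    exact Real.ofReal_le_enorm _
  have key := hT.setIntegral_exp_tsum (measurableSet_Ioc (a := 0) (b := s)) Ioc_subset_Ioi_self
    measure_Ioc_lt_top (f := f) (Measurable.indicator (by fun_prop) measurableSet_Ioi)
    (support_indicator_subset.trans fun x (hx : t < x) =>
      ⟨ht.trans hx, fun h => absurd h.2 (not_le.2 (hst.trans_lt hx))⟩) hfi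
    (z := (ξ * t ^ p : ℝ) * Complex.I) (by simp)
  rw [setIntegral_congr_set (hT.pointCount_Ioc_zero_ae s)] at key
  have hint : ∫ x, (Complex.exp ((ξ * t ^ p : ℝ) * Complex.I * (f x : ℝ)) - 1) =
      t * laterPointsExponent p ξ := by
    rw [← integral_Ioi_exp_rpow_sub_one ht, ← integral_indicator measurableSet_Ioi]
    congr with x
    rw [hcoe]
    by_cases hx : x ∈ Ioi t
    · simp only [indicator_of_mem hx]
      push_cast
      ring_nf
    · simp [indicator_of_notMem hx]
  rw [hint] at key
  have hP : (P.real {ω | s < T 0 ω} : ℂ) = Complex.exp (-(r * volume.real (Ioc 0 s))) := by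
    rw [hT.measureReal_lt_first hs, Real.volume_real_Ioc_of_le hs]
    push_cast
    simp
  rw [hP, ← key]
  refine integral_congr_ae (ae_of_all _ fun ω => ?_)
  simp only [tailSum, hcoe]
  push_cast
  ring_nf

lemma integrable_exp_tailSum (hT : IsPoissonPoints r T P) (p ξ : ℝ) {D : Ω → ℝ}
    (hD : Measurable D) : Integrable (fun ω =>
      Complex.exp ((ξ * (D ω ^ p * tailSum p (fun j => T j ω) (D ω)) : ℝ) * Complex.I)) P := by
  have := hT.measurable_tailSum p hD
  refine Integrable.of_bound (C := 1) (by fun_prop) (ae_of_all _ fun ω => ?_)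
  rw [Complex.norm_exp_ofReal_mul_I]

lemma setIntegral_Ioc_exp_tailSum (hT : IsPoissonPoints r T P) {p : ℝ} (hp : 1 < p) (ξ : ℝ)
    {s t : ℝ} (hs : 0 ≤ s) (hst : s < t) :
    ∫ ω in {ω | T 0 ω ∈ Ioc s t},
        Complex.exp ((ξ * (t ^ p * tailSum p (fun j => T j ω) t) : ℝ) * Complex.I) ∂P =
      P.real {ω | T 0 ω ∈ Ioc s t} * Complex.exp (r * (t * laterPointsExponent p ξ)) := by
  have h1 := hT.setIntegral_lt_exp_tailSum hp ξ hs hst.le (hs.trans_lt hst)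
  have h2 := hT.setIntegral_lt_exp_tailSum hp ξ (hs.trans hst.le) le_rfl (hs.trans_lt hst)
  have hm : ∀ u, MeasurableSet {ω | u < T 0 ω} := fun u =>
    measurableSet_lt measurable_const (hT.measurable 0)
  have hd : {ω | T 0 ω ∈ Ioc s t} = {ω | s < T 0 ω} \ {ω | t < T 0 ω} := by
    ext ω
    simp [mem_Ioc]
  have hsub : {ω | t < T 0 ω} ⊆ {ω | s < T 0 ω} := fun ω (h : t < T 0 ω) => hst.trans h
  rw [hd, setIntegral_sdiff (hm t)
    (hT.integrable_exp_tailSum p ξ (measurable_const (a := t))).integrableOn hsub, h1, h2,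
    measureReal_sdiff hsub (hm t)]
  push_cast
  ring

/-- A discrete form of conditioning on `T 0`: on each cell `((k-1)/n, k/n]` the rounded-up first
point is the constant `k/n`, and the tail beyond it is independent of the cell. -/
lemma integral_exp_tailSum_natCeil (hT : IsPoissonPoints r T P) {p : ℝ} (hp : 1 < p) (ξ : ℝ)
    {n : ℝ} (hn : 0 < n) :
    ∫ ω, Complex.exp ((ξ * ((⌈n * T 0 ω⌉₊ / n) ^ p *
        tailSum p (fun j => T j ω) (⌈n * T 0 ω⌉₊ / n)) : ℝ) * Complex.I) ∂P =
      ∫ ω, Complex.exp (r * laterPointsExponent p ξ * (⌈n * T 0 ω⌉₊ / n : ℝ)) ∂P := by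
  have hm0 := hT.measurable 0
  have hD : Measurable fun ω => (⌈n * T 0 ω⌉₊ / n : ℝ) := by
    have : Measurable fun ω => ⌈n * T 0 ω⌉₊ := Nat.measurable_ceil.comp (by fun_prop)
    fun_prop
  let A : ℕ → Set Ω := fun k => {ω | ⌈n * T 0 ω⌉₊ = k}
  have hAm : ∀ k, MeasurableSet (A k) := fun k =>
    (Nat.measurable_ceil.comp (by fun_prop : Measurable fun ω => n * T 0 ω))
      (measurableSet_singleton k)
  have hAd : Pairwise fun i j => Disjoint (A i) (A j) := by
    intro i j hij
    refine disjoint_left.2 fun ω hi hj => hij ?_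
    exact hi.symm.trans hj
  have hAU : ⋃ k, A k = univ := by
    ext ω
    simp [A]
  have hi1 := hT.integrable_exp_tailSum p ξ hD
  have hi2 : Integrable (fun ω =>
      Complex.exp (r * laterPointsExponent p ξ * (⌈n * T 0 ω⌉₊ / n : ℝ))) P := by
    refine Integrable.of_bound (C := 1) (Measurable.aestronglyMeasurable (by fun_prop))
      (ae_of_all _ fun ω => ?_)
    rw [Complex.norm_exp]
    exact Real.exp_le_one_iff.2
      (re_mul_laterPointsExponent_nonpos hp ξ r.coe_nonneg (by positivity))
  rw [← setIntegral_univ, ← hAU, integral_iUnion hAm hAd hi1.integrableOn]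
  conv_rhs => rw [← setIntegral_univ, ← hAU, integral_iUnion hAm hAd hi2.integrableOn]
  refine tsum_congr fun k => ?_
  obtain rfl | hk := Nat.eq_zero_or_pos k
  -- The cell `k = 0` is `T 0 ≤ 0`, since `⌈·⌉₊` sends all nonpositive reals to `0`.
  · have hnull : P (A 0) = 0 := by
      refine measure_mono_null ?_ (ae_iff.1 hT.pos)
      intro ω (hω : ⌈n * T 0 ω⌉₊ = 0)
      have := Nat.ceil_eq_zero.1 hω
      simp only [mem_ofPred_eq, not_lt]
      exact nonpos_of_mul_nonpos_right this hn
    rw [setIntegral_measure_zero _ hnull, setIntegral_measure_zero _ hnull]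
  · have hk1 : (1 : ℝ) ≤ k := by exact_mod_cast hk
    have hAk : A k = {ω | T 0 ω ∈ Ioc ((k - 1) / n) (k / n)} := by
      ext ω
      simp only [A, mem_ofPred_eq, Nat.ceil_eq_iff hk.ne', mem_Ioc]
      rw [div_lt_iff₀ hn, le_div_iff₀ hn, mul_comm n, Nat.cast_pred hk]
    have hL : ∫ ω in A k, Complex.exp ((ξ * ((⌈n * T 0 ω⌉₊ / n) ^ p *
        tailSum p (fun j => T j ω) (⌈n * T 0 ω⌉₊ / n)) : ℝ) * Complex.I) ∂P =
        ∫ ω in A k, Complex.exp ((ξ * (((k : ℝ) / n) ^ p *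
        tailSum p (fun j => T j ω) ((k : ℝ) / n)) : ℝ) * Complex.I) ∂P :=
      setIntegral_congr_fun (hAm k) fun ω (hω : ⌈n * T 0 ω⌉₊ = k) => by simp only [hω]
    have hR : ∫ ω in A k, Complex.exp (r * laterPointsExponent p ξ * (⌈n * T 0 ω⌉₊ / n : ℝ)) ∂P =
        ∫ ω in A k, Complex.exp (r * laterPointsExponent p ξ * (k / n : ℝ)) ∂P :=
      setIntegral_congr_fun (hAm k) fun ω (hω : ⌈n * T 0 ω⌉₊ = k) => by simp only [hω]
    rw [hL, hR, setIntegral_const, Complex.real_smul, hAk, hT.setIntegral_Ioc_exp_tailSum hp ξ]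
    · congr 2
      ring
    · exact div_nonneg (by linarith) hn.le
    · exact (div_lt_div_iff_of_pos_right hn).2 (by linarith)

/-- The characteristic function of `∑_{j ≥ 1} (T j / T 0) ^ (-p)`. -/
theorem integral_exp_ratio_sum (hT : IsPoissonPoints r T P) (hr : 0 < r) {p : ℝ} (hp : 1 < p)
    (ξ : ℝ) :
    ∫ ω, Complex.exp ((ξ * (T 0 ω ^ p * ∑' j, T (j + 1) ω ^ (-p)) : ℝ) * Complex.I) ∂P =
      (1 - laterPointsExponent p ξ)⁻¹ := by
  have hm0 := hT.measurable 0
  have hΨ := re_laterPointsExponent_nonpos hp ξ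
  have hlaw : ∫ ω, Complex.exp (r * laterPointsExponent p ξ * (T 0 ω : ℝ)) ∂P =
      (1 - laterPointsExponent p ξ)⁻¹ := by
    rw [← integral_exp_mul_expMeasure (r := r) (by exact_mod_cast hr) hΨ, ← hT.map_first hr,
      integral_map hm0.aemeasurable (by fun_prop)]
  rw [← hlaw]
  let D : ℕ → Ω → ℝ := fun n ω => ⌈((n : ℝ) + 1) * T 0 ω⌉₊ / ((n : ℝ) + 1)
  have hDm : ∀ n, Measurable (D n) := fun n => by
    have : Measurable fun ω => ⌈((n : ℝ) + 1) * T 0 ω⌉₊ := Nat.measurable_ceil.comp (by fun_prop)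
    simp only [D]
    fun_prop
  have hDlim : ∀ ω, 0 ≤ T 0 ω → Tendsto (fun n => D n ω) atTop (𝓝 (T 0 ω)) := by
    intro ω h0
    have h := (tendsto_nat_ceil_mul_div_atTop h0).comp
      (tendsto_atTop_add_const_right atTop (1 : ℝ) tendsto_natCast_atTop_atTop)
    refine h.congr fun n => ?_
    simp only [D, Function.comp, mul_comm]
  have hDge : ∀ n ω, T 0 ω ≤ D n ω := by
    intro n ω
    have hn : (0 : ℝ) < (n : ℝ) + 1 := by positivity
    rw [le_div_iff₀ hn, mul_comm]
    exact Nat.le_ceil _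
  have heq := fun n : ℕ => hT.integral_exp_tailSum_natCeil hp ξ (n := (n : ℝ) + 1) (by positivity)
  have hL : Tendsto (fun n => ∫ ω, Complex.exp ((ξ * (D n ω ^ p *
      tailSum p (fun j => T j ω) (D n ω)) : ℝ) * Complex.I) ∂P) atTop
      (𝓝 (∫ ω, Complex.exp ((ξ * (T 0 ω ^ p * ∑' j, T (j + 1) ω ^ (-p)) : ℝ) * Complex.I) ∂P)) := by
    refine tendsto_integral_of_dominated_convergence (fun _ => 1)
      (fun n => (hT.integrable_exp_tailSum p ξ (hDm n)).aestronglyMeasurable) (integrable_const _)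
      (fun n => ae_of_all _ fun ω => by rw [Complex.norm_exp_ofReal_mul_I]) ?_
    filter_upwards [hT.pos, hT.strictMono] with ω h0 hω
    have h01 : T 0 ω < T 1 ω := hω Nat.zero_lt_one
    have hc : ContinuousAt (fun u : ℝ => Complex.exp ((ξ * (u ^ p * ∑' j, T (j + 1) ω ^ (-p)) : ℝ)
        * Complex.I)) (T 0 ω) := by
      have : ContinuousAt (fun u : ℝ => u ^ p) (T 0 ω) :=
        Real.continuousAt_rpow_const _ _ (Or.inl h0.ne')
      fun_prop
    -- Eventually `D n ω` lies in `[T 0 ω, T 1 ω)`, where the tail sum is already the full sum over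
    -- the later points.
    refine (hc.tendsto.comp (hDlim ω h0.le)).congr' ?_
    filter_upwards [(hDlim ω h0.le).eventually_lt_const h01] with n hn
    simp only [Function.comp]
    rw [tailSum_eq_of_mem_Ico hω p ⟨hDge n ω, hn⟩]
  have hR : Tendsto (fun n => ∫ ω, Complex.exp (r * laterPointsExponent p ξ * (D n ω : ℝ)) ∂P) atTop
      (𝓝 (∫ ω, Complex.exp (r * laterPointsExponent p ξ * (T 0 ω : ℝ)) ∂P)) := by
    refine tendsto_integral_of_dominated_convergence (fun _ => 1)
      (fun n => Measurable.aestronglyMeasurable (by have := hDm n; fun_prop)) (integrable_const _) (fun n => ?_) ?_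
    · filter_upwards [hT.pos] with ω h0
      rw [Complex.norm_exp]
      exact Real.exp_le_one_iff.2
        (re_mul_laterPointsExponent_nonpos hp ξ r.coe_nonneg (h0.le.trans (hDge n ω)))
    · filter_upwards [hT.pos] with ω h0
      have hc : Continuous fun u : ℝ => Complex.exp (r * laterPointsExponent p ξ * (u : ℝ)) := by
        fun_prop
      exact (hc.tendsto _).comp (hDlim ω h0.le)
  refine tendsto_nhds_unique hL (hR.congr fun n => ?_)
  exact (heq n).symm

end IsPoissonPoints

/-! ### Gil-Pelaez inversion -/

lemma integral_exp_neg_mul_exp_I {a : ℝ} (ha : 0 < a) (x : ℝ) :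
    ∫ y in Ioi (0 : ℝ), Complex.exp ((-a + x * Complex.I) * y) = (a - x * Complex.I)⁻¹ := by
  rw [integral_exp_mul_complex_Ioi (by simpa using ha)]
  simp only [Complex.ofReal_zero, mul_zero, Complex.exp_zero]
  rw [neg_div, ← div_neg, one_div]
  congr 1
  ring

lemma integral_exp_neg_mul_cos {a : ℝ} (ha : 0 < a) (x : ℝ) :
    ∫ y in Ioi (0 : ℝ), Real.exp (-(a * y)) * Real.cos (x * y) = a / (a ^ 2 + x ^ 2) := by
  have hi : IntegrableOn (fun y : ℝ => Complex.exp ((-a + x * Complex.I) * y)) (Ioi 0) :=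
    integrableOn_exp_mul_complex_Ioi (by simpa using ha) 0
  have h := congrArg Complex.re (integral_exp_neg_mul_exp_I ha x)
  rw [← Complex.reCLM_apply, ← Complex.reCLM.integral_comp_comm hi] at h
  convert h using 1
  · refine integral_congr_ae (ae_of_all _ fun y => ?_)
    simp [Complex.exp_re]
  · simp [Complex.inv_re, Complex.normSq_apply, pow_two]

lemma integrableOn_exp_neg_mul {a : ℝ} (ha : 0 < a) :
    IntegrableOn (fun y : ℝ => Real.exp (-(a * y))) (Ioi 0) := by
  simpa only [neg_mul] using exp_neg_integrableOn_Ioi 0 ha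

lemma integrableOn_exp_neg_mul_sin_div {a : ℝ} (ha : 0 < a) (x : ℝ) :
    IntegrableOn (fun y : ℝ => Real.exp (-(a * y)) * (Real.sin (x * y) / y)) (Ioi 0) := by
  refine Integrable.mono' ((integrableOn_exp_neg_mul ha).mul_const |x|)
    (Measurable.aestronglyMeasurable (by fun_prop)) ?_
  filter_upwards [ae_restrict_mem measurableSet_Ioi] with y hy
  have hy' : (0 : ℝ) < y := hy
  rw [norm_mul, Real.norm_of_nonneg (Real.exp_pos _).le, Real.norm_eq_abs, abs_div,
    abs_of_pos hy']
  refine mul_le_mul_of_nonneg_left ?_ (Real.exp_pos _).le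
  rw [div_le_iff₀ hy', ← abs_of_pos hy', ← abs_mul, abs_of_pos hy']
  exact Real.abs_sin_le_abs

/-- Both sides vanish at `x = 0` and have derivative `a / (a² + x²)`. -/
lemma integral_exp_neg_mul_sin_div {a : ℝ} (ha : 0 < a) (x : ℝ) :
    ∫ y in Ioi (0 : ℝ), Real.exp (-(a * y)) * (Real.sin (x * y) / y) = Real.arctan (x / a) := by
  have hd : ∀ x : ℝ, HasDerivAt
      (fun x => ∫ y in Ioi (0 : ℝ), Real.exp (-(a * y)) * (Real.sin (x * y) / y))
      (a / (a ^ 2 + x ^ 2)) x := by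
    intro x
    rw [← integral_exp_neg_mul_cos ha]
    refine (hasDerivAt_integral_of_dominated_loc_of_deriv_le (s := univ) (x₀ := x)
      (μ := volume.restrict (Ioi 0))
      (F := fun x y => Real.exp (-(a * y)) * (Real.sin (x * y) / y))
      (F' := fun x y => Real.exp (-(a * y)) * Real.cos (x * y))
      (bound := fun y => Real.exp (-(a * y))) univ_mem ?_
      (integrableOn_exp_neg_mul_sin_div ha x) ?_ ?_ (integrableOn_exp_neg_mul ha) ?_).2
    · exact Eventually.of_forall fun x => (integrableOn_exp_neg_mul_sin_div ha x).1
    · exact Measurable.aestronglyMeasurable (by fun_prop)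
    · refine ae_of_all _ fun y x _ => ?_
      rw [norm_mul, Real.norm_of_nonneg (Real.exp_pos _).le]
      exact mul_le_of_le_one_right (Real.exp_pos _).le (Real.abs_cos_le_one _)
    · filter_upwards [ae_restrict_mem measurableSet_Ioi] with y hy x _
      have hy' : y ≠ 0 := (show (0 : ℝ) < y from hy).ne'
      have h := ((((hasDerivAt_id' x).mul_const y).sin).div_const y).const_mul (Real.exp (-(a * y)))
      refine h.congr_deriv ?_
      field_simp
  have hd2 : ∀ x : ℝ, HasDerivAt (fun x => Real.arctan (x / a)) (a / (a ^ 2 + x ^ 2)) x := by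
    intro x
    have h := ((hasDerivAt_id' x).div_const a).arctan
    refine h.congr_deriv ?_
    field_simp
  have hconst := is_const_of_deriv_eq_zero
    (f := fun x => (∫ y in Ioi (0 : ℝ), Real.exp (-(a * y)) * (Real.sin (x * y) / y)) -
      Real.arctan (x / a))
    (fun x => ((hd x).sub (hd2 x)).differentiableAt)
    (fun x => (((hd x).sub (hd2 x)).deriv).trans (sub_self _)) x 0
  simp only [zero_mul, Real.sin_zero, zero_div, mul_zero, integral_zero, Real.arctan_zero,
    sub_zero] at hconst
  linarith

lemma charFun_im_eq_integral_sin (μ : Measure ℝ) [IsFiniteMeasure μ] (y : ℝ) :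
    (charFun μ y).im = ∫ x, Real.sin (x * y) ∂μ := by
  have hi : Integrable (fun x : ℝ => Complex.exp (y * x * Complex.I)) μ := by
    refine Integrable.of_bound (C := 1) (Measurable.aestronglyMeasurable (by fun_prop))
      (ae_of_all _ fun x => ?_)
    rw [← Complex.ofReal_mul, Complex.norm_exp_ofReal_mul_I]
  rw [charFun_apply_real, ← Complex.imCLM_apply, ← Complex.imCLM.integral_comp_comm hi]
  refine integral_congr_ae (ae_of_all _ fun x => ?_)
  simp only [Complex.imCLM_apply]
  rw [← Complex.ofReal_mul, Complex.exp_ofReal_mul_I_im, mul_comm]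

/-- By Fubini `∫ e^(-u) φ(nu) du = ∫ (1 - inx)⁻¹ dμ`. As `n → ∞` the left side tends to `0` and the
right side to the mass at `0`. -/
lemma measureReal_singleton_zero_of_tendsto_charFun (μ : Measure ℝ) [IsProbabilityMeasure μ]
    (h : Tendsto (charFun μ) atTop (𝓝 0)) : μ.real {0} = 0 := by
  have hfub : ∀ n : ℕ, ∫ u in Ioi (0 : ℝ), Real.exp (-u) * charFun μ (n * u) =
      ∫ x, (1 - n * x * Complex.I)⁻¹ ∂μ := by
    intro n
    have hi : Integrable (Function.uncurry fun (u x : ℝ) =>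
        (Real.exp (-u) : ℂ) * Complex.exp ((n * u : ℝ) * x * Complex.I))
        ((volume.restrict (Ioi 0)).prod μ) := by
      have hb := (integrableOn_exp_neg_mul one_pos).mul_prod (integrable_const (μ := μ) (1 : ℝ))
      refine Integrable.mono' hb (Measurable.aestronglyMeasurable (by
        unfold Function.uncurry; fun_prop)) (ae_of_all _ fun z => ?_)
      simp only [Function.uncurry]
      rw [← Complex.ofReal_mul (_ * _), norm_mul, Complex.norm_exp_ofReal_mul_I,
        Complex.norm_real, Real.norm_of_nonneg (Real.exp_pos _).le, one_mul]
    have hl : ∀ u : ℝ, Real.exp (-u) * charFun μ (n * u) =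
        ∫ x, (Real.exp (-u) : ℂ) * Complex.exp ((n * u : ℝ) * x * Complex.I) ∂μ := by
      intro u
      rw [charFun_apply_real, integral_const_mul]
    simp_rw [hl]
    rw [integral_integral_swap hi]
    refine integral_congr_ae (ae_of_all _ fun x => ?_)
    have := integral_exp_neg_mul_exp_I one_pos (n * x)
    simp only [Complex.ofReal_one, Complex.ofReal_mul, Complex.ofReal_natCast] at this ⊢
    rw [← this]
    refine integral_congr_ae (ae_of_all _ fun u => ?_)
    simp only
    rw [Complex.ofReal_exp, ← Complex.exp_add]
    push_cast
    ring_nf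
  have hL : Tendsto (fun n : ℕ => ∫ u in Ioi (0 : ℝ), Real.exp (-u) * charFun μ (n * u)) atTop
      (𝓝 (∫ _u in Ioi (0 : ℝ), (0 : ℂ))) := by
    refine tendsto_integral_of_dominated_convergence (fun u => Real.exp (-(1 * u)))
      (fun n => ?_) (integrableOn_exp_neg_mul one_pos) (fun n => ae_of_all _ fun u => ?_) ?_
    · have := measurable_charFun (μ := μ)
      exact Measurable.aestronglyMeasurable (by fun_prop)
    · rw [norm_mul, Complex.norm_real, Real.norm_of_nonneg (Real.exp_pos _).le, one_mul]
      exact mul_le_of_le_one_right (Real.exp_pos _).le (norm_charFun_le_one _)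
    · filter_upwards [ae_restrict_mem measurableSet_Ioi] with u hu
      have := (h.comp (tendsto_natCast_atTop_atTop.atTop_mul_const (show (0 : ℝ) < u from hu)))
      simpa using this.const_mul (Real.exp (-u) : ℂ)
  have hR : Tendsto (fun n : ℕ => ∫ x, (1 - n * x * Complex.I)⁻¹ ∂μ) atTop
      (𝓝 (∫ x, ({0} : Set ℝ).indicator (fun _ => (1 : ℂ)) x ∂μ)) := by
    refine tendsto_integral_of_dominated_convergence (fun _ => 1)
      (fun n => Measurable.aestronglyMeasurable (by fun_prop)) (integrable_const _)
      (fun n => ae_of_all _ fun x => ?_) (ae_of_all _ fun x => ?_)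
    · rw [norm_inv]
      refine inv_le_one_of_one_le₀ ?_
      have := Complex.abs_re_le_norm (1 - n * x * Complex.I)
      simpa using this
    · by_cases hx : x = 0
      · simp [hx]
      · rw [indicator_of_notMem (by simpa using hx)]
        refine tendsto_inv₀_cobounded.comp ?_
        rw [← tendsto_norm_atTop_iff_cobounded]
        refine tendsto_atTop_mono (f := fun n : ℕ => (n : ℝ) * |x|) (fun n => ?_)
          (tendsto_natCast_atTop_atTop.atTop_mul_const (abs_pos.2 hx))
        have := Complex.abs_im_le_norm (1 - n * x * Complex.I)
        simpa [abs_mul] using this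
  simp_rw [hfub] at hL
  have := tendsto_nhds_unique hL hR
  rw [integral_zero, integral_indicator_const _ (measurableSet_singleton 0)] at this
  simpa using this.symm

/-- The **Gil-Pelaez inversion formula** at the point `0`. -/
theorem gil_pelaez_zero (μ : Measure ℝ) [IsProbabilityMeasure μ]
    (hint : IntegrableOn (fun y => (charFun μ y).im / y) (Ioi 0))
    (hlim : Tendsto (charFun μ) atTop (𝓝 0)) :
    μ.real (Iic 0) = 1 / 2 - 1 / Real.pi * ∫ y in Ioi 0, (charFun μ y).im / y := by
  -- A smooth cutoff between `0` and `1` that tends to `1`. It makes `k n y / y` integrable at both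
  -- ends, so Fubini applies, and it turns `sin (xy) / y` into `arctan ((n+1) x) - arctan
  -- (x/(n+1))`, which tends to `π/2` times the sign of `x`.
  let k : ℕ → ℝ → ℝ := fun n y => Real.exp (-(((n : ℝ) + 1)⁻¹ * y)) - Real.exp (-(((n : ℝ) + 1) * y))
  have hpos : ∀ n : ℕ, (0 : ℝ) < (n : ℝ) + 1 := fun n => by positivity
  have hinvle : ∀ n : ℕ, ((n : ℝ) + 1)⁻¹ ≤ (n : ℝ) + 1 := fun n =>
    (inv_le_one_of_one_le₀ (by simp)).trans (by simp)
  have hk0 : ∀ n y, 0 < y → 0 ≤ k n y := fun n y hy => sub_nonneg.2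
    (Real.exp_le_exp.2 (neg_le_neg (mul_le_mul_of_nonneg_right (hinvle n) hy.le)))
  have hk1 : ∀ n y, 0 < y → k n y ≤ 1 := by
    intro n y hy
    have h1 : Real.exp (-(((n : ℝ) + 1)⁻¹ * y)) ≤ 1 :=
      Real.exp_le_one_iff.2 (neg_nonpos.2 (mul_nonneg (inv_pos.2 (hpos n)).le hy.le))
    have h2 := Real.exp_pos (-(((n : ℝ) + 1) * y))
    simp only [k]
    linarith
  have hkm : ∀ n, Measurable (k n) := fun n => by simp only [k]; fun_prop
  have hki : ∀ n, IntegrableOn (fun y => k n y / y) (Ioi 0) := by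
    intro n
    refine Integrable.mono' ((integrableOn_exp_neg_mul (inv_pos.2 (hpos n))).mul_const
      (((n : ℝ) + 1) - ((n : ℝ) + 1)⁻¹)) ((hkm n).div measurable_id).aestronglyMeasurable ?_
    filter_upwards [ae_restrict_mem measurableSet_Ioi] with y hy
    have hy' : (0 : ℝ) < y := hy
    rw [Real.norm_of_nonneg (div_nonneg (hk0 n y hy') hy'.le), div_le_iff₀ hy']
    have h := Real.add_one_le_exp (-((((n : ℝ) + 1) - ((n : ℝ) + 1)⁻¹) * y))
    have hsplit : Real.exp (-(((n : ℝ) + 1) * y)) = Real.exp (-(((n : ℝ) + 1)⁻¹ * y)) *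
        Real.exp (-((((n : ℝ) + 1) - ((n : ℝ) + 1)⁻¹) * y)) := by
      rw [← Real.exp_add]; ring_nf
    simp only [k]
    rw [hsplit]
    nlinarith [Real.exp_pos (-(((n : ℝ) + 1)⁻¹ * y))]
  have hfub : ∀ n, ∫ y in Ioi (0 : ℝ), k n y * ((charFun μ y).im / y) =
      ∫ x, (Real.arctan (x * ((n : ℝ) + 1)) - Real.arctan (x / ((n : ℝ) + 1))) ∂μ := by
    intro n
    have hi : Integrable (Function.uncurry fun (y x : ℝ) => k n y / y * Real.sin (x * y))
        ((volume.restrict (Ioi 0)).prod μ) := by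
      refine Integrable.mono' ((hki n).norm.mul_prod (integrable_const (μ := μ) (1 : ℝ)))
        (Measurable.aestronglyMeasurable ?_) (ae_of_all _ fun z => ?_)
      · have := hkm n
        unfold Function.uncurry
        fun_prop
      · simp only [Function.uncurry]
        rw [norm_mul]
        exact mul_le_mul_of_nonneg_left (Real.abs_sin_le_one _) (norm_nonneg _)
    have hl : ∀ y, k n y * ((charFun μ y).im / y) = ∫ x, k n y / y * Real.sin (x * y) ∂μ := by
      intro y
      rw [charFun_im_eq_integral_sin, integral_const_mul]
      ring
    simp_rw [hl]
    rw [integral_integral_swap hi]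
    refine integral_congr_ae (ae_of_all _ fun x => ?_)
    simp only
    rw [← div_inv_eq_mul x, ← integral_exp_neg_mul_sin_div (inv_pos.2 (hpos n)),
      ← integral_exp_neg_mul_sin_div (hpos n), ← integral_sub
        (integrableOn_exp_neg_mul_sin_div (inv_pos.2 (hpos n)) x)
        (integrableOn_exp_neg_mul_sin_div (hpos n) x)]
    refine integral_congr_ae (ae_of_all _ fun y => ?_)
    simp only [k]
    ring
  have htop : Tendsto (fun n : ℕ => (n : ℝ) + 1) atTop atTop :=
    tendsto_atTop_add_const_right _ _ tendsto_natCast_atTop_atTop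
  have hL : Tendsto (fun n => ∫ y in Ioi (0 : ℝ), k n y * ((charFun μ y).im / y)) atTop
      (𝓝 (∫ y in Ioi 0, (charFun μ y).im / y)) := by
    refine tendsto_integral_of_dominated_convergence (fun y => ‖(charFun μ y).im / y‖)
      (fun n => ?_) hint.norm (fun n => ?_) ?_
    · exact (hkm n).aestronglyMeasurable.mul hint.1
    · filter_upwards [ae_restrict_mem measurableSet_Ioi] with y hy
      rw [norm_mul, Real.norm_of_nonneg (hk0 n y hy)]
      exact mul_le_of_le_one_left (norm_nonneg _) (hk1 n y hy)
    · filter_upwards [ae_restrict_mem measurableSet_Ioi] with y hy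
      have hy' : (0 : ℝ) < y := hy
      have h1 : Tendsto (fun n : ℕ => Real.exp (-(((n : ℝ) + 1)⁻¹ * y))) atTop (𝓝 1) := by
        have := ((tendsto_inv_atTop_zero.comp htop).mul_const y).neg.rexp
        simpa using this
      have h2 : Tendsto (fun n : ℕ => Real.exp (-(((n : ℝ) + 1) * y))) atTop (𝓝 0) :=
        Real.tendsto_exp_neg_atTop_nhds_zero.comp (htop.atTop_mul_const hy')
      simpa using (h1.sub h2).mul_const ((charFun μ y).im / y)
  have hR : Tendsto (fun n : ℕ => ∫ x, (Real.arctan (x * ((n : ℝ) + 1)) -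
      Real.arctan (x / ((n : ℝ) + 1))) ∂μ) atTop
      (𝓝 (∫ x, ((Ioi 0).indicator (fun _ => Real.pi / 2) x -
        (Iio 0).indicator (fun _ => Real.pi / 2) x) ∂μ)) := by
    refine tendsto_integral_of_dominated_convergence (fun _ => Real.pi)
      (fun n => Measurable.aestronglyMeasurable (by fun_prop)) (integrable_const _)
      (fun n => ae_of_all _ fun x => ?_) (ae_of_all _ fun x => ?_)
    · have h1 := Real.arctan_lt_pi_div_two (x * ((n : ℝ) + 1))
      have h2 := Real.neg_pi_div_two_lt_arctan (x * ((n : ℝ) + 1))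
      have h3 := Real.arctan_lt_pi_div_two (x / ((n : ℝ) + 1))
      have h4 := Real.neg_pi_div_two_lt_arctan (x / ((n : ℝ) + 1))
      rw [Real.norm_eq_abs, abs_le]
      constructor <;> linarith
    · have hsmall : Tendsto (fun n : ℕ => Real.arctan (x / ((n : ℝ) + 1))) atTop (𝓝 0) := by
        have := (Real.continuous_arctan.tendsto _).comp ((tendsto_const_nhds (x := x)).div_atTop htop)
        simpa [Function.comp_def] using this
      rcases lt_trichotomy x 0 with hx | hx | hx
      · rw [indicator_of_notMem (by simpa using hx.le), indicator_of_mem (by exact hx)]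
        have := (Real.tendsto_arctan_atBot.mono_right nhdsWithin_le_nhds).comp
          (htop.const_mul_atTop_of_neg hx)
        simpa using this.sub hsmall
      · simp [hx]
      · rw [indicator_of_mem (by exact hx), indicator_of_notMem (by simpa using hx.le)]
        have := (Real.tendsto_arctan_atTop.mono_right nhdsWithin_le_nhds).comp
          (htop.const_mul_atTop hx)
        simpa using this.sub hsmall
  simp_rw [hfub] at hL
  have heq := tendsto_nhds_unique hL hR
  rw [integral_sub ((integrable_const _).indicator measurableSet_Ioi)
    ((integrable_const _).indicator measurableSet_Iio),
    integral_indicator_const _ measurableSet_Ioi, integral_indicator_const _ measurableSet_Iio] at heq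
  -- The limit is `π/2 * (μ(0, ∞) - μ(-∞, 0))`; it determines `μ(-∞, 0]` only once an atom at `0` is
  -- excluded.
  have hatom := measureReal_singleton_zero_of_tendsto_charFun μ hlim
  have hIic : μ.real (Iic 0) = μ.real (Iio 0) := by
    rw [← Iio_union_right, measureReal_union (by simp) (measurableSet_singleton 0), hatom, add_zero]
  have hIoi : μ.real (Ioi 0) = 1 - μ.real (Iic 0) := by
    rw [← compl_Iic, probReal_compl_eq_one_sub measurableSet_Iic]
  rw [heq, hIoi, ← hIic]
  simp only [smul_eq_mul]
  field_simp
  ring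

/-! ### Bounds for the exponent -/

lemma norm_laterPointsExponent_le {p : ℝ} (hp : 1 < p) (ξ : ℝ) :
    ‖laterPointsExponent p ξ‖ ≤ |ξ| * (p - 1)⁻¹ := by
  have hi : IntegrableOn (fun v : ℝ => |ξ| * v ^ (-p)) (Ioi 1) :=
    (integrableOn_Ioi_rpow_of_lt (by linarith) one_pos).const_mul _
  refine (norm_integral_le_of_norm_le hi ?_).trans_eq ?_
  · filter_upwards [ae_restrict_mem measurableSet_Ioi] with v hv
    refine (norm_exp_ofReal_mul_I_sub_one_le _).trans ?_
    have : 0 < v := zero_lt_one.trans hv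
    rw [abs_mul, abs_of_pos (Real.rpow_pos_of_pos this _)]
  · rw [integral_const_mul, integral_Ioi_rpow_of_lt (by linarith) one_pos, Real.one_rpow]
    congr 1
    rw [neg_div, ← div_neg, one_div]
    congr 1
    ring

lemma one_sub_laterPointsExponent_ne_zero {p : ℝ} (hp : 1 < p) (ξ : ℝ) :
    1 - laterPointsExponent p ξ ≠ 0 := by
  intro h
  have h1 := congrArg Complex.re h
  have h2 := re_laterPointsExponent_nonpos hp ξ
  simp at h1
  linarith

lemma one_le_norm_one_sub_laterPointsExponent {p : ℝ} (hp : 1 < p) (ξ : ℝ) :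
    1 ≤ ‖1 - laterPointsExponent p ξ‖ := by
  have h1 := Complex.abs_re_le_norm (1 - laterPointsExponent p ξ)
  have h2 := re_laterPointsExponent_nonpos hp ξ
  rw [Complex.sub_re, Complex.one_re] at h1
  exact le_trans (by linarith) ((le_abs_self _).trans h1)

/-- Keep only the `v` with `1 ≤ y v⁻ᵖ ≤ 2`, where `1 - cos` is at least `1 - cos 1`. They fill an
interval of length proportional to `y^(1/p)`, and `y ≥ 2` places it inside `v > 1`. -/
lemma exists_rpow_le_norm_one_sub_laterPointsExponent {p : ℝ} (hp : 1 < p) :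
    ∃ C : ℝ, 0 < C ∧ ∀ y : ℝ, 2 ≤ y → C * y ^ (1 / p) ≤ ‖1 - laterPointsExponent p y‖ := by
  have hp0 : 0 < p := zero_lt_one.trans hp
  have hcos : Real.cos 1 < 1 := by
    have := Real.cos_lt_cos_of_nonneg_of_le_pi le_rfl (by linarith [Real.pi_gt_three])
      (zero_lt_one (α := ℝ))
    rwa [Real.cos_zero] at this
  have h2 : ((1 : ℝ) / 2) ^ (1 / p) < 1 :=
    Real.rpow_lt_one (by norm_num) (by norm_num) (by positivity)
  refine ⟨(1 - Real.cos 1) * (1 - (1 / 2) ^ (1 / p)),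
    mul_pos (by linarith) (by linarith), fun y hy => ?_⟩
  have hy0 : 0 < y := by linarith
  have hire : IntegrableOn (fun v : ℝ => 1 - Real.cos (y * v ^ (-p))) (Ioi 1) := by
    have := ((integrableOn_laterPointsExponent hp y).re).neg
    refine this.congr (ae_of_all _ fun v => ?_)
    simp only [Pi.neg_apply, RCLike.re_eq_complex_re, Complex.sub_re, Complex.exp_ofReal_mul_I_re,
      Complex.one_re]
    ring
  have hre : (1 - laterPointsExponent p y).re =
      1 + ∫ v in Ioi (1 : ℝ), (1 - Real.cos (y * v ^ (-p))) := by
    rw [Complex.sub_re, Complex.one_re, laterPointsExponent, ← Complex.reCLM_apply,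
      ← Complex.reCLM.integral_comp_comm (integrableOn_laterPointsExponent hp y), sub_eq_add_neg,
      ← integral_neg]
    congr 1
    refine integral_congr_ae (ae_of_all _ fun v => ?_)
    simp only [Complex.reCLM_apply, Complex.sub_re, Complex.exp_ofReal_mul_I_re, Complex.one_re]
    ring
  have hle : (y / 2) ^ (1 / p) ≤ y ^ (1 / p) :=
    Real.rpow_le_rpow (by positivity) (by linarith) (by positivity)
  have hsub : Ioc ((y / 2) ^ (1 / p)) (y ^ (1 / p)) ⊆ Ioi 1 := by
    intro v hv
    exact (Real.one_le_rpow (by linarith) (by positivity)).trans_lt hv.1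
  have hlow : (1 - Real.cos 1) * (y ^ (1 / p) - (y / 2) ^ (1 / p)) ≤
      ∫ v in Ioi (1 : ℝ), (1 - Real.cos (y * v ^ (-p))) := by
    refine le_trans ?_ (setIntegral_mono_set hire
      (ae_of_all _ fun v => sub_nonneg.2 (Real.cos_le_one _)) hsub.eventuallyLE)
    rw [← Real.volume_real_Ioc_of_le hle]
    refine setIntegral_ge_of_const_le_real measurableSet_Ioc measure_Ioc_lt_top.ne ?_
      (hire.mono_set hsub)
    intro v hv
    have hv0 : 0 < v := zero_lt_one.trans (hsub hv)
    have hvp : 0 < v ^ p := Real.rpow_pos_of_pos hv0 p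
    have hup : v ^ p ≤ y := by
      have := Real.rpow_le_rpow hv0.le hv.2 hp0.le
      rwa [← Real.rpow_mul hy0.le, one_div_mul_cancel hp0.ne', Real.rpow_one] at this
    have hlo : y / 2 ≤ v ^ p := by
      have := Real.rpow_le_rpow (by positivity) hv.1.le hp0.le
      rwa [← Real.rpow_mul (by positivity), one_div_mul_cancel hp0.ne', Real.rpow_one] at this
    have e1 : 1 ≤ y * v ^ (-p) := by
      rw [Real.rpow_neg hv0.le, ← div_eq_mul_inv, one_le_div hvp]
      exact hup
    have e2 : y * v ^ (-p) ≤ 2 := by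
      rw [Real.rpow_neg hv0.le, ← div_eq_mul_inv, div_le_iff₀ hvp]
      linarith
    have := Real.cos_le_cos_of_nonneg_of_le_pi zero_le_one (by linarith [Real.pi_gt_three]) e1
    linarith
  have hsplit : (y / 2) ^ (1 / p) = (1 / 2) ^ (1 / p) * y ^ (1 / p) := by
    rw [← Real.mul_rpow (by norm_num) hy0.le]
    congr 1
    ring
  refine le_trans ?_ ((le_abs_self _).trans (Complex.abs_re_le_norm _))
  rw [hre]
  rw [hsplit] at hlow
  nlinarith

/-! ### The exponent as an incomplete gamma function -/

/-- The integral `∫₀¹ w^(-1/p) exp (i y w) dw`. -/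
noncomputable def unitFourierIntegral (p y : ℝ) : ℂ :=
  ∫ w in Ioc (0 : ℝ) 1, (w ^ (-(1 / p)) : ℝ) * Complex.exp ((y * w : ℝ) * Complex.I)

/-- Substitute `w = v⁻ᵖ`: then `w^(-1/p) = v`, and the Jacobian is `p v^(-p-1)`. -/
lemma unitFourierIntegral_eq {p : ℝ} (hp : 1 < p) (y : ℝ) :
    unitFourierIntegral p y = ∫ v in Ioi (1 : ℝ),
      (p * v ^ (-p) : ℝ) * Complex.exp ((y * v ^ (-p) : ℝ) * Complex.I) := by
  have hp0 : 0 < p := zero_lt_one.trans hp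
  let g : ℝ → ℂ := (Ioo 0 1).indicator fun w =>
    (w ^ (-(1 / p)) : ℝ) * Complex.exp ((y * w : ℝ) * Complex.I)
  have hg : ∫ w in Ioi 0, g w = unitFourierIntegral p y := by
    rw [unitFourierIntegral, integral_Ioc_eq_integral_Ioo, setIntegral_indicator measurableSet_Ioo]
    congr 2
    ext w
    simp only [mem_inter_iff, mem_Ioi, mem_Ioo]
    tauto
  rw [← hg, ← integral_comp_rpow_Ioi g (neg_ne_zero.2 hp0.ne')]
  have hsplit : ∀ x ∈ Ioi (0 : ℝ), (|-p| * x ^ (-p - 1)) • g (x ^ (-p)) =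
      (Ioi 1).indicator (fun v : ℝ =>
        (p * v ^ (-p) : ℝ) * Complex.exp ((y * v ^ (-p) : ℝ) * Complex.I)) x := by
    intro x hx
    have hx0 : (0 : ℝ) < x := hx
    by_cases h1 : x ∈ Ioi (1 : ℝ)
    · have hmem : x ^ (-p) ∈ Ioo (0 : ℝ) 1 :=
        ⟨Real.rpow_pos_of_pos hx0 _, Real.rpow_lt_one_of_one_lt_of_neg h1 (neg_neg_of_pos hp0)⟩
      simp only [g]
      rw [indicator_of_mem hmem, indicator_of_mem h1, Complex.real_smul, ← mul_assoc,
        ← Complex.ofReal_mul]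
      congr 2
      rw [← Real.rpow_mul hx0.le, abs_neg, abs_of_pos hp0, mul_assoc, ← Real.rpow_add hx0]
      congr 2
      field_simp
      ring
    · have hnot : x ^ (-p) ∉ Ioo (0 : ℝ) 1 := by
        intro h
        have hx1 : x ≤ 1 := not_lt.1 h1
        exact absurd h.2 (not_lt.2 (Real.one_le_rpow_of_pos_of_le_one_of_nonpos hx0 hx1
          (neg_nonpos.2 hp0.le)))
      simp only [g]
      rw [indicator_of_notMem hnot, indicator_of_notMem h1, smul_zero]
  rw [setIntegral_congr_fun measurableSet_Ioi hsplit, setIntegral_indicator measurableSet_Ioi]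
  congr 2
  ext x
  simp only [mem_inter_iff, mem_Ioi]
  constructor
  · exact fun h => h.2
  · exact fun h => ⟨zero_lt_one.trans h, h⟩

/-- Integrate by parts against the primitive `v` of `1`. The boundary term at `1` is `exp (iy) - 1`;
the one at infinity is `O(v^(1-p))` and vanishes. -/
lemma one_sub_laterPointsExponent {p : ℝ} (hp : 1 < p) (y : ℝ) :
    1 - laterPointsExponent p y =
      Complex.exp (y * Complex.I) - Complex.I * y * unitFourierIntegral p y := by
  let u : ℝ → ℂ := fun v => Complex.exp ((y * v ^ (-p) : ℝ) * Complex.I) - 1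
  let u' : ℝ → ℂ := fun v =>
    Complex.exp ((y * v ^ (-p) : ℝ) * Complex.I) * ((y * (-p * v ^ (-p - 1)) : ℝ) * Complex.I)
  have hu : ∀ x ∈ Ioi (1 : ℝ), HasDerivAt u (u' x) x := by
    intro x hx
    have hx0 : x ≠ 0 := (zero_lt_one.trans hx).ne'
    exact ((((Real.hasDerivAt_rpow_const (p := -p) (Or.inl hx0)).const_mul y).ofReal_comp).mul_const
      Complex.I).cexp.sub_const 1
  have hv : ∀ x ∈ Ioi (1 : ℝ), HasDerivAt (fun x : ℝ => (x : ℂ)) 1 x := fun x _ =>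
    Complex.ofRealCLM.hasDerivAt
  have hprod : ∀ x ∈ Ioi (1 : ℝ), u' x * x =
      -(Complex.I * y) * ((p * x ^ (-p) : ℝ) * Complex.exp ((y * x ^ (-p) : ℝ) * Complex.I)) := by
    intro x hx
    have hx0 : (0 : ℝ) < x := zero_lt_one.trans hx
    have : x ^ (-p) = x ^ (-p - 1) * x := by
      nth_rewrite 3 [← Real.rpow_one x]
      rw [← Real.rpow_add hx0]
      ring_nf
    simp only [u']
    generalize Complex.exp _ = E
    rw [this]
    push_cast
    ring
  have hi : IntegrableOn (fun x : ℝ =>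
      ((p * x ^ (-p) : ℝ) : ℂ) * Complex.exp ((y * x ^ (-p) : ℝ) * Complex.I)) (Ioi 1) := by
    have hb : IntegrableOn (fun v : ℝ => p * v ^ (-p)) (Ioi 1) :=
      (integrableOn_Ioi_rpow_of_lt (by linarith) one_pos).const_mul _
    refine Integrable.mono' hb.norm (Measurable.aestronglyMeasurable (by fun_prop))
      (ae_of_all _ fun x => ?_)
    rw [norm_mul, Complex.norm_exp_ofReal_mul_I, mul_one, Complex.norm_real]
  have hiu : IntegrableOn (u * fun _ => (1 : ℂ)) (Ioi 1) := by
    simpa [u, Pi.mul_def] using integrableOn_laterPointsExponent hp y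
  have hiu' : IntegrableOn (u' * fun x : ℝ => (x : ℂ)) (Ioi 1) :=
    IntegrableOn.congr_fun (hi.const_mul (-(Complex.I * y))) (fun x hx => (hprod x hx).symm)
      measurableSet_Ioi
  have hzero : Tendsto (u * fun x : ℝ => (x : ℂ)) (𝓝[>] 1)
      (𝓝 (Complex.exp (y * Complex.I) - 1)) := by
    have hc : ContinuousAt (u * fun x : ℝ => (x : ℂ)) 1 := by
      have : ContinuousAt (fun v : ℝ => v ^ (-p)) 1 :=
        Real.continuousAt_rpow_const _ _ (Or.inl one_ne_zero)
      simp only [u, Pi.mul_def]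
      fun_prop
    have h := hc.tendsto
    simp only [u, Pi.mul_apply, Real.one_rpow, mul_one, Complex.ofReal_one] at h
    exact h.mono_left nhdsWithin_le_nhds
  have hinf : Tendsto (u * fun x : ℝ => (x : ℂ)) atTop (𝓝 0) := by
    have hlim : Tendsto (fun x : ℝ => |y| * x ^ (-(p - 1))) atTop (𝓝 (|y| * 0)) :=
      (tendsto_rpow_neg_atTop (by linarith)).const_mul _
    rw [mul_zero] at hlim
    refine squeeze_zero_norm' ?_ hlim
    filter_upwards [eventually_gt_atTop 0] with x hx
    rw [Pi.mul_apply, norm_mul, Complex.norm_real, Real.norm_of_nonneg hx.le]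
    calc ‖u x‖ * x ≤ |y * x ^ (-p)| * x :=
          mul_le_mul_of_nonneg_right (norm_exp_ofReal_mul_I_sub_one_le _) hx.le
      _ = |y| * x ^ (-(p - 1)) := by
          rw [abs_mul, abs_of_pos (Real.rpow_pos_of_pos hx _), mul_assoc]
          nth_rewrite 2 [← Real.rpow_one x]
          rw [← Real.rpow_add hx]
          ring_nf
  have key := integral_Ioi_mul_deriv_eq_deriv_mul hu hv hiu hiu' hzero hinf
  simp only [mul_one] at key
  rw [setIntegral_congr_fun measurableSet_Ioi hprod, integral_const_mul,
    ← unitFourierIntegral_eq hp] at key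
  rw [laterPointsExponent, key]
  ring

lemma Complex.ofReal_mul_cpow {t : ℝ} (ht : 0 < t) {z : ℂ} (hz : z ≠ 0) (s : ℝ) :
    ((t : ℂ) * z) ^ (s : ℂ) = (t ^ s : ℝ) * z ^ (s : ℂ) := by
  have ht' : (t : ℂ) ≠ 0 := by exact_mod_cast ht.ne'
  rw [Complex.cpow_def_of_ne_zero (mul_ne_zero ht' hz), Complex.log_ofReal_mul ht hz, add_mul,
    Complex.exp_add, Complex.cpow_def_of_ne_zero hz, Real.rpow_def_of_pos ht]
  push_cast
  rfl

lemma lowerGamma_neg_inv {c : ℝ} (hc : 1 / 2 < c) {y : ℝ} (hy : 0 < y) :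
    lowerGamma (-(1 / (2 * c))) (-(Complex.I * y)) =
      -(2 * c) * (((y ^ (-(1 / (2 * c))) : ℝ) : ℂ) * Complex.exp (Real.pi / (4 * c) * Complex.I)) *
        (1 - laterPointsExponent (2 * c) y) := by
  have hc0 : 0 < c := by linarith
  have hcC : (c : ℂ) ≠ 0 := by exact_mod_cast hc0.ne'
  have hs : (-(1 / (2 * c)) : ℂ) = ((-(1 / (2 * c)) : ℝ) : ℂ) := by push_cast; rfl
  have hlt : 1 / (2 * c) < 1 := by rw [div_lt_one (by positivity)]; linarith
  have hpos : 0 < 1 / (2 * c) := by positivity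
  have hyC : (y : ℂ) ≠ 0 := by exact_mod_cast hy.ne'
  have hz : (-(Complex.I * y) : ℂ) ≠ 0 := neg_ne_zero.2 (mul_ne_zero Complex.I_ne_zero hyC)
  -- Since `-1/(2c)` lies in `(-1, 0)`, exactly one step of the recursion is used.
  have hfloor : ⌊1 - (-(1 / (2 * c)) : ℂ).re⌋₊ = 1 := by
    rw [hs, Complex.ofReal_re, Nat.floor_eq_iff (by linarith)]
    constructor
    · push_cast; linarith
    · push_cast; linarith
  -- The principal argument of `-iy` is `-π/2`; multiplied by `-1/(2c)` it gives the phase `π/(4c)`.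
  have hzs : (-(Complex.I * y) : ℂ) ^ (-(1 / (2 * c)) : ℂ) =
      ((y ^ (-(1 / (2 * c))) : ℝ) : ℂ) * Complex.exp (Real.pi / (4 * c) * Complex.I) := by
    rw [show (-(Complex.I * y) : ℂ) = (y : ℂ) * (-Complex.I) by ring, hs,
      Complex.ofReal_mul_cpow hy (neg_ne_zero.2 Complex.I_ne_zero),
      Complex.cpow_def_of_ne_zero (neg_ne_zero.2 Complex.I_ne_zero), Complex.log_neg_I]
    congr 2
    push_cast
    field_simp
    ring
  have hint : lowerGammaIntegral (-(1 / (2 * c)) + 1) (-(Complex.I * y)) =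
      (-(Complex.I * y) : ℂ) ^ (-(1 / (2 * c)) : ℂ) *
        (-(Complex.I * y) * unitFourierIntegral (2 * c) y) := by
    rw [lowerGammaIntegral, intervalIntegral.integral_of_le zero_le_one, unitFourierIntegral,
      ← integral_const_mul, ← integral_const_mul]
    refine setIntegral_congr_fun measurableSet_Ioc fun t ht => ?_
    rw [add_sub_cancel_right, hs, Complex.ofReal_mul_cpow ht.1 hz]
    have he : Complex.exp (-((t : ℂ) * -(Complex.I * y))) =
        Complex.exp ((y * t : ℝ) * Complex.I) := by
      congr 1
      push_cast
      ring
    rw [he]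
    ring
  have hexp : Complex.exp (-(-(Complex.I * y))) = Complex.exp (y * Complex.I) := by
    congr 1
    ring
  rw [lowerGamma, hfloor, lowerGammaAux, lowerGammaAux, hint, hexp,
    one_sub_laterPointsExponent (by linarith), ← hzs]
  field_simp
  ring

/-! ### Existence, uniqueness and monotonicity for the critical exponent -/

section RpowSum

variable {q : ℕ → ℝ}

lemma strictAntiOn_tsum_rpow (h0 : ∀ j, 0 < q j) (h1 : ∀ j, q j < 1)
    (hs : ∀ p : ℝ, 1 < p → Summable fun j => q j ^ p) :
    StrictAntiOn (fun p : ℝ => ∑' j, q j ^ p) (Ioi 1) := fun a ha b hb hab =>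
  Summable.tsum_lt_tsum (i := 0)
    (fun j => (Real.rpow_lt_rpow_of_exponent_gt (h0 j) (h1 j) hab).le)
    (Real.rpow_lt_rpow_of_exponent_gt (h0 0) (h1 0) hab) (hs b hb) (hs a ha)

lemma continuousOn_tsum_rpow (h0 : ∀ j, 0 < q j) (h1 : ∀ j, q j < 1)
    (hs : ∀ p : ℝ, 1 < p → Summable fun j => q j ^ p) :
    ContinuousOn (fun p : ℝ => ∑' j, q j ^ p) (Ioi 1) := by
  intro p hp
  obtain ⟨a, ha1, hap⟩ := exists_between (show (1 : ℝ) < p from hp)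
  have h : ContinuousOn (fun p : ℝ => ∑' j, q j ^ p) (Ici a) := by
    refine continuousOn_tsum (u := fun j => q j ^ a)
      (fun j => (Real.continuous_const_rpow (h0 j).ne').continuousOn) (hs a ha1) ?_
    intro j b hb
    rw [Real.norm_of_nonneg (Real.rpow_pos_of_pos (h0 j) _).le]
    exact Real.rpow_le_rpow_of_exponent_ge (h0 j) (h1 j).le hb
  exact (h.continuousAt (Ici_mem_nhds hap)).continuousWithinAt

/-- Divergence at exponent `1` gives a finite partial sum above `1`, and finite sums are continuous
in the exponent. -/
lemma exists_one_lt_tsum_rpow (h0 : ∀ j, 0 < q j)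
    (hs : ∀ p : ℝ, 1 < p → Summable fun j => q j ^ p) (hn : ¬ Summable q) :
    ∃ p : ℝ, 1 < p ∧ 1 < ∑' j, q j ^ p := by
  have h := (not_summable_iff_tendsto_nat_atTop_of_nonneg fun j => (h0 j).le).1 hn
  obtain ⟨n, hn⟩ := (h.eventually_gt_atTop 1).exists
  have hc : Continuous fun p : ℝ => ∑ j ∈ Finset.range n, q j ^ p :=
    continuous_finsetSum _ fun j _ => Real.continuous_const_rpow (h0 j).ne'
  have hev : ∀ᶠ p : ℝ in 𝓝[>] 1, 1 < ∑ j ∈ Finset.range n, q j ^ p := by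
    refine (hc.tendsto 1).mono_left nhdsWithin_le_nhds |>.eventually_const_lt ?_
    simpa using hn
  obtain ⟨p, hp, hp1⟩ := (hev.and self_mem_nhdsWithin).exists
  exact ⟨p, hp1, hp.trans_le ((hs p hp1).sum_le_tsum _
    fun j _ => (Real.rpow_pos_of_pos (h0 j) _).le)⟩

/-- Compare `q j ^ (2 + k) ≤ q 0 ^ k * q j ^ 2` and let `k → ∞`. The bound `b` allows the exponent
to be chosen to the right of a given one, for the intermediate value theorem. -/
lemma exists_tsum_rpow_lt_one (h0 : ∀ j, 0 < q j) (h1 : ∀ j, q j < 1) (ha : ∀ j, q j ≤ q 0)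
    (hs : ∀ p : ℝ, 1 < p → Summable fun j => q j ^ p) (b : ℝ) :
    ∃ p : ℝ, 1 < p ∧ b ≤ p ∧ ∑' j, q j ^ p < 1 := by
  have hlim : Tendsto (fun k : ℝ => q 0 ^ k * ∑' j, q j ^ (2 : ℝ)) atTop
      (𝓝 (0 * ∑' j, q j ^ (2 : ℝ))) :=
    (tendsto_rpow_atTop_of_base_lt_one _ (by linarith [h0 0]) (h1 0)).mul_const _
  rw [zero_mul] at hlim
  obtain ⟨k, hk, hk0, hkb⟩ := ((hlim.eventually_lt_const one_pos).and
    ((eventually_ge_atTop 0).and (eventually_ge_atTop b))).exists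
  refine ⟨2 + k, by linarith, by linarith, lt_of_le_of_lt ?_ hk⟩
  rw [← tsum_mul_left]
  refine Summable.tsum_le_tsum (fun j => ?_) (hs _ (by linarith)) ((hs 2 (by norm_num)).mul_left _)
  rw [add_comm, Real.rpow_add (h0 j)]
  exact mul_le_mul_of_nonneg_right (Real.rpow_le_rpow (h0 j).le (ha j) hk0)
    (Real.rpow_pos_of_pos (h0 j) _).le

lemma exists_tsum_rpow_eq_one (h0 : ∀ j, 0 < q j) (h1 : ∀ j, q j < 1) (ha : ∀ j, q j ≤ q 0)
    (hs : ∀ p : ℝ, 1 < p → Summable fun j => q j ^ p) (hn : ¬ Summable q) :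
    ∃ p : ℝ, 1 < p ∧ ∑' j, q j ^ p = 1 := by
  obtain ⟨a, ha1, hga⟩ := exists_one_lt_tsum_rpow h0 hs hn
  obtain ⟨b, hb1, hab, hgb⟩ := exists_tsum_rpow_lt_one h0 h1 ha hs a
  have hsub : Icc a b ⊆ Ioi 1 := fun p hp => ha1.trans_le hp.1
  obtain ⟨p, hp, hp1⟩ := intermediate_value_Icc' hab
    ((continuousOn_tsum_rpow h0 h1 hs).mono hsub) (show (1 : ℝ) ∈ Icc _ _ from ⟨hgb.le, hga.le⟩)
  exact ⟨p, hsub hp, hp1⟩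

end RpowSum

section CriticalExponent

variable {x : ℕ → ℝ}

lemma isCriticalExponent_iff (h0 : 0 < x 0) (hx : StrictMono x)
    (hs : ∀ p : ℝ, 1 < p → Summable fun j => x j ^ (-p)) (σ : ℝ) :
    IsCriticalExponent x σ ↔ 1 / 2 < σ ∧ ∑' j, (x 0 / x (j + 1)) ^ (2 * σ) = 1 := by
  have hpos : ∀ j, 0 < x j := fun j => h0.trans_le (hx.monotone (Nat.zero_le j))
  refine and_congr_right fun hσ => ?_
  have hsum : Summable fun j => x (j + 1) ^ (-(2 * σ)) :=
    (summable_nat_add_iff 1).2 (hs (2 * σ) (by linarith))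
  have heq : ∀ j, (x 0 / x (j + 1)) ^ (2 * σ) = x 0 ^ (2 * σ) * x (j + 1) ^ (-(2 * σ)) := by
    intro j
    rw [Real.div_rpow h0.le (hpos _).le, Real.rpow_neg (hpos _).le, div_eq_mul_inv]
  have hx0 : 0 < x 0 ^ (2 * σ) := Real.rpow_pos_of_pos h0 _
  simp_rw [heq]
  rw [tsum_mul_left, hsum.hasSum_iff, Real.rpow_neg h0.le, ← mul_one (x 0 ^ (2 * σ))⁻¹,
    eq_inv_mul_iff_mul_eq₀ hx0.ne']

variable (h0 : 0 < x 0) (hx : StrictMono x)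
  (hs : ∀ p : ℝ, 1 < p → Summable fun j => x j ^ (-p))

include h0 hx

lemma ratio_pos (j : ℕ) : 0 < x 0 / x (j + 1) :=
  div_pos h0 (h0.trans (hx (Nat.succ_pos j)))

lemma ratio_lt_one (j : ℕ) : x 0 / x (j + 1) < 1 :=
  (div_lt_one (h0.trans (hx (Nat.succ_pos j)))).2 (hx (Nat.succ_pos j))

include hs

lemma summable_ratio_rpow (p : ℝ) (hp : 1 < p) : Summable fun j => (x 0 / x (j + 1)) ^ p := by
  have hpos : ∀ j, 0 < x j := fun j => h0.trans_le (hx.monotone (Nat.zero_le j))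
  have heq : ∀ j, (x 0 / x (j + 1)) ^ p = x 0 ^ p * x (j + 1) ^ (-p) := by
    intro j
    rw [Real.div_rpow h0.le (hpos _).le, Real.rpow_neg (hpos _).le, div_eq_mul_inv]
  simp_rw [heq]
  exact ((summable_nat_add_iff 1).2 (hs p hp)).mul_left _

lemma existsUnique_isCriticalExponent (hn : ¬ Summable fun j => (x j)⁻¹) :
    ∃! σ, IsCriticalExponent x σ := by
  have hsr := summable_ratio_rpow h0 hx hs
  have hnr : ¬ Summable fun j => x 0 / x (j + 1) := by
    intro h
    refine hn ((summable_nat_add_iff 1).1 ?_)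
    simpa [div_eq_mul_inv, summable_mul_left_iff h0.ne'] using h
  obtain ⟨p, hp, hp1⟩ := exists_tsum_rpow_eq_one (ratio_pos h0 hx) (ratio_lt_one h0 hx)
    (fun j => div_le_div_of_nonneg_left h0.le (h0.trans (hx Nat.zero_lt_one))
      (hx.monotone (by omega))) hsr hnr
  refine ⟨p / 2, (isCriticalExponent_iff h0 hx hs _).2 ⟨by linarith, ?_⟩, ?_⟩
  · rwa [mul_div_cancel₀ _ two_ne_zero]
  · intro σ hσ
    obtain ⟨h1, h2⟩ := (isCriticalExponent_iff h0 hx hs _).1 hσ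
    have := (strictAntiOn_tsum_rpow (ratio_pos h0 hx) (ratio_lt_one h0 hx) hsr).injOn
      (show 2 * σ ∈ Ioi (1 : ℝ) by simp only [mem_Ioi]; linarith) hp (h2.trans hp1.symm)
    linarith

lemma isCriticalExponent_criticalExponent (hn : ¬ Summable fun j => (x j)⁻¹) :
    IsCriticalExponent x (criticalExponent x) := by
  have h := existsUnique_isCriticalExponent h0 hx hs hn
  rw [criticalExponent, dif_pos h]
  exact h.choose_spec.1

/-- The ratio sum strictly decreases in the exponent and equals `1` at the critical one. -/
lemma criticalExponent_le_iff (hn : ¬ Summable fun j => (x j)⁻¹) {c : ℝ} (hc : 1 / 2 < c) :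
    criticalExponent x ≤ c ↔ x 0 ^ (2 * c) * ∑' j, x (j + 1) ^ (-(2 * c)) ≤ 1 := by
  have hpos : ∀ j, 0 < x j := fun j => h0.trans_le (hx.monotone (Nat.zero_le j))
  obtain ⟨h1, h2⟩ := (isCriticalExponent_iff h0 hx hs _).1
    (isCriticalExponent_criticalExponent h0 hx hs hn)
  have heq : x 0 ^ (2 * c) * ∑' j, x (j + 1) ^ (-(2 * c)) = ∑' j, (x 0 / x (j + 1)) ^ (2 * c) := by
    rw [← tsum_mul_left]
    refine tsum_congr fun j => ?_
    rw [Real.div_rpow h0.le (hpos _).le, Real.rpow_neg (hpos _).le, div_eq_mul_inv]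
  have hanti := strictAntiOn_tsum_rpow (ratio_pos h0 hx) (ratio_lt_one h0 hx)
    (summable_ratio_rpow h0 hx hs)
  have := hanti.le_iff_ge (show 2 * c ∈ Ioi (1 : ℝ) by simp only [mem_Ioi]; linarith)
    (show 2 * criticalExponent x ∈ Ioi (1 : ℝ) by simp only [mem_Ioi]; linarith)
  simp only [h2] at this
  rw [heq, this]
  constructor <;> intro h <;> linarith

end CriticalExponent

/-! ### Integrability and the gamma form of the integrand -/

/-- The characteristic function of `∑_{j ≥ 1} (T j / T 0) ^ (-p) - 1`. -/
noncomputable def shiftedRatioCharFun (p y : ℝ) : ℂ :=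
  Complex.exp (-(y * Complex.I)) * (1 - laterPointsExponent p y)⁻¹

/-- Subtracting `1` leaves the imaginary part unchanged, and both factors differ from `1` by `O(y)`.
Hence the Gil-Pelaez integrand is bounded near `0`. -/
lemma abs_im_shiftedRatioCharFun_le {p : ℝ} (hp : 1 < p) {y : ℝ} (hy : 0 < y) :
    |(shiftedRatioCharFun p y).im| ≤ y * (1 + (p - 1)⁻¹) := by
  set Ψ := laterPointsExponent p y
  have hne : 1 - Ψ ≠ 0 := one_sub_laterPointsExponent_ne_zero hp y
  have hexp : Complex.exp (-(y * Complex.I)) = Complex.exp ((-y : ℝ) * Complex.I) := by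
    congr 1
    push_cast
    ring
  have h1 : ‖Complex.exp (-(y * Complex.I)) - 1‖ ≤ y := by
    rw [hexp]
    refine (norm_exp_ofReal_mul_I_sub_one_le _).trans ?_
    rw [abs_neg, abs_of_pos hy]
  have h2 : ‖(1 - Ψ)⁻¹ - 1‖ ≤ y * (p - 1)⁻¹ := by
    have : (1 - Ψ)⁻¹ - 1 = Ψ * (1 - Ψ)⁻¹ := by field_simp; ring
    rw [this, norm_mul, norm_inv]
    refine (mul_le_of_le_one_right (norm_nonneg _) (inv_le_one_of_one_le₀
      (one_le_norm_one_sub_laterPointsExponent hp y))).trans ?_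
    have := norm_laterPointsExponent_le hp y
    rwa [abs_of_pos hy] at this
  have hdecomp : shiftedRatioCharFun p y - 1 =
      Complex.exp (-(y * Complex.I)) * ((1 - Ψ)⁻¹ - 1) + (Complex.exp (-(y * Complex.I)) - 1) := by
    rw [shiftedRatioCharFun]
    ring
  have him : (shiftedRatioCharFun p y).im = (shiftedRatioCharFun p y - 1).im := by simp
  rw [him]
  refine (Complex.abs_im_le_norm _).trans ?_
  rw [hdecomp]
  refine (norm_add_le _ _).trans ?_
  rw [norm_mul, hexp, Complex.norm_exp_ofReal_mul_I, one_mul, ← hexp]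
  linarith

lemma norm_shiftedRatioCharFun (p y : ℝ) :
    ‖shiftedRatioCharFun p y‖ = ‖1 - laterPointsExponent p y‖⁻¹ := by
  have hexp : Complex.exp (-(y * Complex.I)) = Complex.exp ((-y : ℝ) * Complex.I) := by
    congr 1
    push_cast
    ring
  rw [shiftedRatioCharFun, norm_mul, hexp, Complex.norm_exp_ofReal_mul_I, one_mul, norm_inv]

lemma exists_norm_shiftedRatioCharFun_le {p : ℝ} (hp : 1 < p) :
    ∃ C : ℝ, ∀ y : ℝ, 2 ≤ y → ‖shiftedRatioCharFun p y‖ ≤ C * y ^ (-(1 / p)) := by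
  obtain ⟨C, hC, h⟩ := exists_rpow_le_norm_one_sub_laterPointsExponent hp
  refine ⟨C⁻¹, fun y hy => ?_⟩
  have hy0 : 0 < y := by linarith
  rw [norm_shiftedRatioCharFun, Real.rpow_neg hy0.le, ← mul_inv]
  exact inv_anti₀ (mul_pos hC (Real.rpow_pos_of_pos hy0 _)) (h y hy)

lemma tendsto_shiftedRatioCharFun {p : ℝ} (hp : 1 < p) :
    Tendsto (shiftedRatioCharFun p) atTop (𝓝 0) := by
  obtain ⟨C, h⟩ := exists_norm_shiftedRatioCharFun_le hp
  have hlim : Tendsto (fun y : ℝ => C * y ^ (-(1 / p))) atTop (𝓝 (C * 0)) :=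
    (tendsto_rpow_neg_atTop (by positivity)).const_mul _
  rw [mul_zero] at hlim
  refine squeeze_zero_norm' ?_ hlim
  filter_upwards [eventually_ge_atTop 2] with y hy using h y hy

lemma integrableOn_im_shiftedRatioCharFun_div {p : ℝ} (hp : 1 < p)
    (hm : Measurable (shiftedRatioCharFun p)) :
    IntegrableOn (fun y => (shiftedRatioCharFun p y).im / y) (Ioi 0) := by
  obtain ⟨C, hC⟩ := exists_norm_shiftedRatioCharFun_le hp
  have hm' : Measurable fun y => (shiftedRatioCharFun p y).im / y :=
    (Complex.measurable_im.comp hm).div measurable_id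
  rw [← Ioc_union_Ioi_eq_Ioi (show (0 : ℝ) ≤ 2 by norm_num), integrableOn_union]
  constructor
  · refine Integrable.mono' (integrableOn_const (C := 1 + (p - 1)⁻¹) measure_Ioc_lt_top.ne)
      hm'.aestronglyMeasurable ?_
    filter_upwards [ae_restrict_mem measurableSet_Ioc] with y hy
    rw [Real.norm_eq_abs, abs_div, abs_of_pos hy.1, div_le_iff₀ hy.1, mul_comm]
    exact abs_im_shiftedRatioCharFun_le hp hy.1
  · have hi : IntegrableOn (fun y : ℝ => C * y ^ (-(1 / p) - 1)) (Ioi 2) := by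
      refine (integrableOn_Ioi_rpow_of_lt ?_ two_pos).const_mul _
      have : 0 < 1 / p := by positivity
      linarith
    refine Integrable.mono' hi hm'.aestronglyMeasurable ?_
    filter_upwards [ae_restrict_mem measurableSet_Ioi] with y hy
    have hy2 : (2 : ℝ) < y := hy
    have hy0 : 0 < y := by linarith
    rw [Real.norm_eq_abs, abs_div, abs_of_pos hy0, Real.rpow_sub_one hy0.ne', ← mul_div_assoc]
    exact div_le_div_of_nonneg_right ((Complex.abs_im_le_norm _).trans (hC y hy2.le)) hy0.le

/-- The phase `exp (iπ/(4c))` cancels against the one in `γ`, and the powers of `y` combine to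
`1/y`. The remaining `-1/(2c)` turns the prefactor `2c/π` into the `-1/π` of the inversion formula.
-/
lemma exp_div_lowerGamma_im {c : ℝ} (hc : 1 / 2 < c) {y : ℝ} (hy : 0 < y) :
    (Complex.exp ((Real.pi / (4 * c) - y) * Complex.I) /
      lowerGamma (-(1 / (2 * c))) (-(Complex.I * y))).im * y ^ (-1 - 1 / (2 * c)) =
      -(1 / (2 * c)) * ((shiftedRatioCharFun (2 * c) y).im / y) := by
  have hc0 : 0 < c := by linarith
  have hcC : (c : ℂ) ≠ 0 := by exact_mod_cast hc0.ne'
  have hpow : 0 < y ^ (-(1 / (2 * c))) := Real.rpow_pos_of_pos hy _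
  have hpowC : ((y ^ (-(1 / (2 * c))) : ℝ) : ℂ) ≠ 0 := by exact_mod_cast hpow.ne'
  have hne := one_sub_laterPointsExponent_ne_zero (p := 2 * c) (by linarith) y
  have hsplit : Complex.exp ((Real.pi / (4 * c) - y) * Complex.I) =
      Complex.exp (Real.pi / (4 * c) * Complex.I) * Complex.exp (-(y * Complex.I)) := by
    rw [← Complex.exp_add]
    congr 1
    ring
  have hE := Complex.exp_ne_zero (Real.pi / (4 * c) * Complex.I)
  have hquot : Complex.exp ((Real.pi / (4 * c) - y) * Complex.I) /
      lowerGamma (-(1 / (2 * c))) (-(Complex.I * y)) =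
      ((-(1 / (2 * c)) * (y ^ (-(1 / (2 * c))))⁻¹ : ℝ) : ℂ) * shiftedRatioCharFun (2 * c) y := by
    rw [lowerGamma_neg_inv hc hy, hsplit, shiftedRatioCharFun]
    generalize Complex.exp (Real.pi / (4 * c) * Complex.I) = E at *
    push_cast
    field_simp
  rw [hquot, Complex.im_ofReal_mul, show (-1 - 1 / (2 * c) : ℝ) = -(1 / (2 * c)) - 1 by ring,
    Real.rpow_sub_one hy.ne']
  field_simp

/-! ### The distribution function of the critical exponent -/

namespace IsPoissonPoints

variable {Ω : Type*} [MeasurableSpace Ω] {r : ℝ≥0} {T : ℕ → Ω → ℝ} {P : Measure Ω}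
  [IsProbabilityMeasure P]

omit [IsProbabilityMeasure P] in
lemma measurable_ratio_sum (hT : IsPoissonPoints r T P) (p : ℝ) :
    Measurable fun ω => T 0 ω ^ p * ∑' j, T (j + 1) ω ^ (-p) := by
  have := hT.measurable
  fun_prop

lemma charFun_map_ratio_sum_sub_one (hT : IsPoissonPoints r T P) (hr : 0 < r) {p : ℝ}
    (hp : 1 < p) (y : ℝ) :
    charFun (P.map fun ω => T 0 ω ^ p * ∑' j, T (j + 1) ω ^ (-p) - 1) y =
      shiftedRatioCharFun p y := by
  have hm := hT.measurable_ratio_sum p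
  rw [charFun_apply_real, integral_map (hm.sub_const 1).aemeasurable (by fun_prop),
    shiftedRatioCharFun, ← hT.integral_exp_ratio_sum hr hp, ← integral_const_mul]
  refine integral_congr_ae (ae_of_all _ fun ω => ?_)
  simp only
  rw [← Complex.exp_add]
  congr 1
  push_cast
  ring

lemma measureReal_ratio_sum_le_one (hT : IsPoissonPoints r T P) (hr : 0 < r) {p : ℝ}
    (hp : 1 < p) :
    IntegrableOn (fun y => (shiftedRatioCharFun p y).im / y) (Ioi 0) ∧
    P.real {ω | T 0 ω ^ p * ∑' j, T (j + 1) ω ^ (-p) ≤ 1} =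
      1 / 2 - 1 / Real.pi * ∫ y in Ioi 0, (shiftedRatioCharFun p y).im / y := by
  have hm := (hT.measurable_ratio_sum p).sub_const 1
  have hφ : charFun (P.map fun ω => T 0 ω ^ p * ∑' j, T (j + 1) ω ^ (-p) - 1) =
      shiftedRatioCharFun p := funext (hT.charFun_map_ratio_sum_sub_one hr hp)
  have : IsProbabilityMeasure (P.map fun ω => T 0 ω ^ p * ∑' j, T (j + 1) ω ^ (-p) - 1) :=
    Measure.isProbabilityMeasure_map hm.aemeasurable
  have hi := integrableOn_im_shiftedRatioCharFun_div hp (hφ ▸ measurable_charFun)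
  have key := gil_pelaez_zero _ (by rw [hφ]; exact hi) (hφ ▸ tendsto_shiftedRatioCharFun hp)
  rw [hφ, map_measureReal_apply hm measurableSet_Iic] at key
  refine ⟨hi, ?_⟩
  rw [← key]
  congr 1
  ext ω
  simp

lemma ae_criticalExponent_le_iff (hT : IsPoissonPoints r T P) (hr : 0 < r) :
    ∀ᵐ ω ∂P, (∃! σ, IsCriticalExponent (fun j => T j ω) σ) ∧
      1 / 2 < criticalExponent (fun j => T j ω) ∧
      ∀ c : ℝ, 1 / 2 < c → (criticalExponent (fun j => T j ω) ≤ c ↔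
        T 0 ω ^ (2 * c) * ∑' j, T (j + 1) ω ^ (-(2 * c)) ≤ 1) := by
  filter_upwards [hT.pos, hT.strictMono, hT.ae_summable_rpow, hT.ae_not_summable_inv hr]
    with ω h0 hx hs hn
  exact ⟨existsUnique_isCriticalExponent h0 hx hs hn,
    (isCriticalExponent_criticalExponent h0 hx hs hn).1,
    fun c hc => criticalExponent_le_iff h0 hx hs hn hc⟩

lemma aemeasurable_criticalExponent (hT : IsPoissonPoints r T P) (hr : 0 < r) :
    AEMeasurable (fun ω => criticalExponent (fun j => T j ω)) P := by
  -- Sublevel sets agree with measurable sets only up to null sets (with the empty set if `c ≤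
  -- 1/2`), so measurability is shown for the completed σ-algebra.
  have h : @Measurable (NullMeasurableSpace Ω P) ℝ _ _
      fun ω => criticalExponent (fun j => T j ω) := by
    refine measurable_of_Iic fun c => ?_
    change NullMeasurableSet {ω | criticalExponent (fun j => T j ω) ≤ c} P
    by_cases hc : 1 / 2 < c
    · have hm : MeasurableSet {ω | T 0 ω ^ (2 * c) * ∑' j, T (j + 1) ω ^ (-(2 * c)) ≤ 1} :=
        measurableSet_le (hT.measurable_ratio_sum _) measurable_const
      refine hm.nullMeasurableSet.congr ?_
      filter_upwards [hT.ae_criticalExponent_le_iff hr] with ω hω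
      exact propext (hω.2.2 c hc).symm
    · refine (MeasurableSet.empty).nullMeasurableSet.congr ?_
      filter_upwards [hT.ae_criticalExponent_le_iff hr] with ω hω
      refine propext ⟨False.elim, fun h => hc (hω.2.1.trans_le h)⟩
  exact NullMeasurable.aemeasurable fun s hs => h hs

end IsPoissonPoints

theorem theorem3 {Ω : Type*} [MeasurableSpace Ω] (P : Measure Ω) [IsProbabilityMeasure P]
    (T : ℕ → Ω → ℝ) (hT : IsPoissonPoints (1 / 2) T P) :
    (∀ᵐ ω ∂P, ∃! σ, IsCriticalExponent (fun j => T j ω) σ) ∧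
    AEMeasurable (fun ω => criticalExponent (fun j => T j ω)) P ∧
    ∀ c : ℝ, 1 / 2 < c →
      (∀ y : ℝ, 0 < y → lowerGamma (-(1 / (2 * c))) (-(Complex.I * y)) ≠ 0) ∧
      IntegrableOn (fun y : ℝ =>
        (Complex.exp ((Real.pi / (4 * c) - y) * Complex.I) /
          lowerGamma (-(1 / (2 * c))) (-(Complex.I * y))).im * y ^ (-1 - 1 / (2 * c)))
        (Ioi 0) ∧
      P.real {ω | criticalExponent (fun j => T j ω) ≤ c} =
        1 / 2 + 2 * c / Real.pi * ∫ y in Ioi (0 : ℝ),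
          (Complex.exp ((Real.pi / (4 * c) - y) * Complex.I) /
            lowerGamma (-(1 / (2 * c))) (-(Complex.I * y))).im * y ^ (-1 - 1 / (2 * c)) := by
  have hr : (0 : ℝ≥0) < 1 / 2 := by positivity
  have hae := hT.ae_criticalExponent_le_iff hr
  refine ⟨hae.mono fun ω hω => hω.1, hT.aemeasurable_criticalExponent hr, fun c hc => ?_⟩
  have hc0 : 0 < c := by linarith
  have hp : 1 < 2 * c := by linarith
  obtain ⟨hi, hP⟩ := hT.measureReal_ratio_sum_le_one hr hp
  refine ⟨fun y hy => ?_, ?_, ?_⟩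
  · rw [lowerGamma_neg_inv hc hy]
    have hcC : (c : ℂ) ≠ 0 := by exact_mod_cast hc0.ne'
    have hpow : ((y ^ (-(1 / (2 * c))) : ℝ) : ℂ) ≠ 0 := by
      exact_mod_cast (Real.rpow_pos_of_pos hy _).ne'
    exact mul_ne_zero (mul_ne_zero (neg_ne_zero.2 (mul_ne_zero two_ne_zero hcC))
      (mul_ne_zero hpow (Complex.exp_ne_zero _))) (one_sub_laterPointsExponent_ne_zero hp y)
  · exact IntegrableOn.congr_fun (hi.const_mul (-(1 / (2 * c))))
      (fun y hy => (exp_div_lowerGamma_im hc hy).symm) measurableSet_Ioi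
  · have hset : {ω | criticalExponent (fun j => T j ω) ≤ c} =ᵐ[P]
        {ω | T 0 ω ^ (2 * c) * ∑' j, T (j + 1) ω ^ (-(2 * c)) ≤ 1} := by
      filter_upwards [hae] with ω hω
      exact propext (hω.2.2 c hc)
    rw [measureReal_congr hset, hP, setIntegral_congr_fun measurableSet_Ioi
      (fun y hy => exp_div_lowerGamma_im hc hy), integral_const_mul]
    field_simp
    ring
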